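/- \textbf{Setting.} Let $H=\mathbb C((t))$, $H'=H/\mathbb C$, with the symplectic form $\langle f,g\rangle=-\operatorname{Res}_{t=0} f\,dg$, and $H'_+=t\mathbb C[[t]]\subset H'$. Let $\Gamma$ be a positive-definite even lattice of finite rank, $\mathfrak h_\Gamma=\Gamma\otimes_{\mathbb Z}\mathbb C$, and let $\widehat{\mathfrak h}_\Gamma=\mathfrak h_\Gamma((t))\oplus\mathbb C\mathbf 1$ be the Heisenberg Lie algebra, with $\mathbf 1$ central and $[A\otimes f,B\otimes g]=-(A,B)(\operatorname{Res} f\,dg)\mathbf 1$. Let $\pi^0_\Gamma$ be the level-$0$ Heisenberg vertex algebra, i.e. the $\widehat{\mathfrak h}_\Gamma$-module induced from the one-dimensional module $\mathbb C|0\rangle$ of $\mathfrak h_\Gamma[[t]]\oplus\mathbb C\mathbf 1$ on which everything acts by $0$. Since $A\otimes t^0$ acts on it by $0$, $A\otimes f$ acts on it for $A\in\mathfrak h_\Gamma$, $f\in H'$. A PPAV $(X,\Theta)$ is a complex torus $X=W/\Lambda$ with a positive-definite Hermitian form $B$ on $W$ (antilinear in the first variable) such that $\operatorname{Im}B$ is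 integral and unimodular on $\Lambda$; then $T_0X=W$, and evaluation of one-forms at the origin is a map $W\to H^0(X,\Omega^1_X)^*$. An extended PPAV of dimension $g$ is a triple $a=(Z,F,L)$ with $Z=Z^\perp\subset H'$, $F\subset Z$ of codimension $g$, and $L$ a lattice of rank $2g$ in $F^\perp/F$, such that $Z\cap H'_+=0$; $L_{\mathbb R}\cap F^\perp_+=0$ in $F^\perp/F$, where $F^\perp_+=F^\perp\cap H'_+$; the complex conjugation of $F^\perp/F$ defined by $L_{\mathbb R}$ takes $Z/F$ to $F^\perp_+$; $\frac1{2\pi i}\langle\,,\rangle$ is integral and unimodular on $L$; and $B_a(u,v)=\frac1\pi\langle\overline u,v\rangle$ is positive definite on $Z/F$. Its underlying PPAV is the quotient of $Z/F$ by the image of $L$ under the projection $F^\perp/F\to Z/F$ along $F^\perp_+$, with the form $B_a$. Let $\mathrm{Sp}(X,\Theta)$ be the set of pairs $x=(a,\iota)$ of an extended PPAV $a=(Z,F,L)$ and an isomorphism $\iota$ from its underlying PPAV to $(X,\Theta)$; for such $x$ write $\iota_x\colon Z\to Z/F\cong W\to H^0(X,\Omega^1_X)^*$ for the induced map. Let $\mathbb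 S\mathrm p^+(H')$ be the identity component (for the weak operator topology) of the group of continuous symplectic automorphisms $\rho$ of $H'$ with $\rho(H'_+)=H'_+$. It acts on $\mathrm{Sp}(X,\Theta)$, and it acts on $\pi^0_\Gamma$ by fixing $|0\rangle$ and by $\rho\circ(A\otimes f)\circ\rho^{-1}=A\otimes\rho(f)$. The space of coinvariants at $a=(Z,F,L)$ is $\widehat{\mathbb V}(a,\pi^0_\Gamma)=\pi^0_\Gamma/(\mathfrak h_\Gamma\otimes F)\,\pi^0_\Gamma$. The space of coinvariants $\mathbb V(X,\Theta,\pi^0_\Gamma)$ of the PPAV is obtained from these by descent along $\mathrm{Sp}(X,\Theta)$: it is the space of families $(v_x)_{x\in\mathrm{Sp}(X,\Theta)}$ with $v_x\in\widehat{\mathbb V}(a,\pi^0_\Gamma)$ for $x=(a,\iota)$ and $\rho\,v_x=v_{\rho x}$ for all $\rho\in\mathbb S\mathrm p^+(H')$. \textbf{Theorem.} Let $(X,\Theta)$ be a PPAV. For every $x=(a,\iota)$ in $\mathrm{Sp}(X,\Theta)$ the evaluation $\mathbb V(X,\Theta,\pi^0_\Gamma)\to\widehat{\mathbb V}(a,\pi^0_\Gamma)$,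 $v\mapsto v_x$, is bijective, and there is a canonical isomorphism \[ \mathbb V(X,\Theta,\pi^0_\Gamma)\;\cong\;\mathrm{Sym}\bigl(\mathfrak h_\Gamma\otimes_{\mathbb C}H^0(X,\Omega^1_X)^*\bigr), \] namely a unique linear isomorphism that, for all $x=(a,\iota)$ with $a=(Z,F,L)$, all $A_i\in\mathfrak h_\Gamma$ and all $f_i\in Z$, sends every $v$ with $v_x=[(A_1\otimes f_1)\cdots(A_k\otimes f_k)|0\rangle]$ to $\prod_i A_i\otimes\iota_x(f_i)$. Equivalently, \[ \mathbb V(X,\Theta,\pi^0_\Gamma)\cong\mathrm{Fun}\bigl(\mathfrak h_\Gamma\otimes_{\mathbb C}H^0(X,\Omega^1_X)\bigr), \] the ring of polynomial functions, by the unique linear isomorphism sending such a $v$ to the product of the linear forms $B\otimes\eta\mapsto(A_i,B)\,\iota_x(f_i)(\eta)$. In particular, if $\Gamma$ has rank one and $h\in\mathfrak h_\Gamma$ satisfies $(h,h)=1$, there are unique linear isomorphisms $\mathbb V(X,\Theta,\pi^0_\Gamma)\cong\mathrm{Sym}(H^0(X,\Omega^1_X)^*)$ and $\mathbb V(X,\Theta,\pi^0_\Gamma)\cong\mathrm{Fun}(H^0(X,\Omega^1_X))$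 which send every $v$ with $v_x=[(h\otimes f_1)\cdots(h\otimes f_k)|0\rangle]$, $f_i\in Z$, to $\prod_i\iota_x(f_i)$, respectively to the function $\eta\mapsto\prod_i\iota_x(f_i)(\eta)$. -/

import Mathlib

open scoped TensorProduct

noncomputable section

namespace AbelianCoinvariants

/-! ### The symplectic space `H' = ℂ((t)) / ℂ` -/

/-- The space `H = ℂ((t))`. -/
def H : Type := LaurentSeries ℂ

instance : AddCommGroup H := inferInstanceAs (AddCommGroup (HahnSeries ℤ ℂ))

instance : Module ℂ H := HahnSeries.instModule (Γ := ℤ) (R := ℂ) (V := ℂ)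

/-- The `n`-th coefficient of a Laurent series. -/
def coeff (n : ℤ) : H →ₗ[ℂ] ℂ where
  toFun f := HahnSeries.coeff f n
  map_add' _ _ := rfl
  map_smul' _ _ := rfl

/-- The constant series `b₀ = 1`. -/
def bZero : H := (1 : LaurentSeries ℂ)

theorem coeff_bZero (n : ℤ) : coeff n bZero = if n = 0 then 1 else 0 := by
  refine (HahnSeries.coeff_one (R := ℂ) (a := n)).trans ?_
  congr

/-- The product of Laurent series. -/
def mulH (f g : H) : H := HMul.hMul (α := LaurentSeries ℂ) (β := LaurentSeries ℂ) f g

theorem smul_eq_mulH (c : ℂ) (f : H) : c • f = mulH (HahnSeries.single (0 : ℤ) c) f :=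
  (HahnSeries.single_zero_mul_eq_smul (Γ := ℤ) (r := c) (x := f)).symm

/-- The derivative of Laurent series. -/
def derivH : H →ₗ[ℂ] H := LaurentSeries.derivative (V := ℂ) ℂ

theorem coeff_derivH (n : ℤ) (f : H) : coeff n (derivH f) = ((n + 1 : ℤ) : ℂ) * coeff (n + 1) f := by
  have h : coeff n (derivH f) = Ring.choose (n + ((1 : ℕ) : ℤ)) 1 • coeff (n + ((1 : ℕ) : ℤ)) f := rfl
  rw [h, Ring.choose_one_right, Nat.cast_one, zsmul_eq_mul]

/-- The form `⟨f, g⟩ = - Res f dg` on `H`. -/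
def formH : H →ₗ[ℂ] H →ₗ[ℂ] ℂ :=
  LinearMap.mk₂ ℂ (fun f g => -coeff (-1) (mulH f (derivH g)))
    (fun f f' g => by
      have h : mulH (f + f') (derivH g) = mulH f (derivH g) + mulH f' (derivH g) :=
        add_mul (R := LaurentSeries ℂ) f f' (derivH g)
      rw [h, map_add, neg_add])
    (fun c f g => by
      have h : mulH (c • f) (derivH g) = c • mulH f (derivH g) := by
        rw [smul_eq_mulH, smul_eq_mulH]
        exact mul_assoc (G := LaurentSeries ℂ) _ _ _
      rw [h, map_smul, smul_neg])
    (fun f g g' => by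
      have h : mulH f (derivH g + derivH g') = mulH f (derivH g) + mulH f (derivH g') :=
        mul_add (R := LaurentSeries ℂ) f (derivH g) (derivH g')
      rw [map_add, h, map_add, neg_add])
    (fun c f g => by
      have h : mulH f (c • derivH g) = c • mulH f (derivH g) := by
        rw [smul_eq_mulH, smul_eq_mulH]
        exact mul_left_comm (G := LaurentSeries ℂ) _ _ _
      rw [map_smul, h, map_smul, smul_neg])

theorem formH_apply (f g : H) : formH f g = -coeff (-1) (mulH f (derivH g)) := rfl

theorem formH_eq_finsum (f g : H) :
    formH f g = -∑ᶠ n : ℤ, (n : ℂ) * coeff (-n) f * coeff n g := by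
  classical
  rw [formH_apply]
  congr 1
  have h0 : coeff (-1) (mulH f (derivH g)) =
      ∑ p ∈ Finset.antidiagonal (HahnSeries.isPWO_support f)
        (HahnSeries.isPWO_support (derivH g)) (-1), coeff p.1 f * coeff p.2 (derivH g) := rfl
  rw [h0]
  have hinj : Set.InjOn (fun p : ℤ × ℤ => p.2 + 1)
      (Finset.antidiagonal (HahnSeries.isPWO_support f)
        (HahnSeries.isPWO_support (derivH g)) (-1) : Set (ℤ × ℤ)) := by
    rintro ⟨a, b⟩ h1 ⟨c, d⟩ h2 h
    simp only [Finset.mem_coe, Finset.mem_antidiagonal] at h1 h2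
    simp only at h
    ext <;> simp only <;> omega
  rw [finsum_eq_sum_of_support_subset (s := (Finset.antidiagonal (HahnSeries.isPWO_support f)
      (HahnSeries.isPWO_support (derivH g)) (-1)).image (fun p : ℤ × ℤ => p.2 + 1)),
    Finset.sum_image hinj]
  · refine Finset.sum_congr rfl fun p hp => ?_
    rw [Finset.mem_antidiagonal] at hp
    have h1 : p.1 = -(p.2 + 1) := by omega
    rw [coeff_derivH, ← h1]
    ring
  · intro n hn
    rw [Function.mem_support] at hn
    have h1 : (n : ℂ) ≠ 0 := fun h => hn (by simp [h])
    have h2 : coeff (-n) f ≠ 0 := fun h => hn (by simp [h])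
    have h3 : coeff n g ≠ 0 := fun h => hn (by simp [h])
    simp only [Finset.coe_image, Set.mem_image, Finset.mem_coe, Finset.mem_antidiagonal]
    refine ⟨(-n, n - 1), ⟨h2, ?_, by ring⟩, by simp⟩
    change coeff (n - 1) (derivH g) ≠ 0
    rw [coeff_derivH, sub_add_cancel]
    exact mul_ne_zero h1 h3

theorem formH_skew (f g : H) : formH f g = -formH g f := by
  rw [formH_eq_finsum, formH_eq_finsum, neg_neg, ← finsum_neg_distrib,
    ← finsum_comp_equiv (Equiv.neg ℤ)]
  refine finsum_congr fun n => ?_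
  simp
  ring

/-- The line `ℂ b₀` of constants in `H`. -/
def constLine : Submodule ℂ H := Submodule.span ℂ {bZero}

theorem bZero_mem : bZero ∈ constLine := Submodule.subset_span rfl

theorem formH_const_right (f : H) {g : H} (hg : g ∈ constLine) : formH f g = 0 := by
  obtain ⟨c, rfl⟩ := Submodule.mem_span_singleton.1 hg
  rw [map_smul, formH_eq_finsum]
  have : (fun n : ℤ => (n : ℂ) * coeff (-n) f * coeff n bZero) = fun _ => 0 := by
    funext n
    by_cases h : n = 0 <;> simp [h, coeff_bZero]
  rw [this, finsum_zero, neg_zero, smul_zero]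

theorem formH_const_left {f : H} (hf : f ∈ constLine) (g : H) : formH f g = 0 := by
  rw [formH_skew, formH_const_right g hf, neg_zero]

/-- The space `H' = H / ℂ b₀`. -/
abbrev H' : Type := H ⧸ constLine

/-- The symplectic form on `H'` induced by `- Res f dg`. -/
def form : H' →ₗ[ℂ] H' →ₗ[ℂ] ℂ :=
  formH.liftQ₂ constLine constLine
    (fun _ hf => LinearMap.ext fun g => formH_const_left hf g)
    (fun _ hg => LinearMap.ext fun f => formH_const_right f hg)

theorem form_mk (f g : H) : form (constLine.mkQ f) (constLine.mkQ g) = formH f g := rfl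

theorem form_skew (f g : H') : form f g = -form g f := by
  obtain ⟨f, rfl⟩ := constLine.mkQ_surjective f
  obtain ⟨g, rfl⟩ := constLine.mkQ_surjective g
  exact formH_skew f g

/-- The subspace `t ^ n ℂ[[t]]` of `H`. -/
def tPow (n : ℤ) : Submodule ℂ H := ⨅ m : {m : ℤ // m < n}, LinearMap.ker (coeff m)

theorem mem_tPow {n : ℤ} {f : H} : f ∈ tPow n ↔ ∀ m < n, coeff m f = 0 := by
  simp [tPow, Submodule.mem_iInf]

/-- The image of `t ^ n ℂ[[t]]` in `H'`; these subspaces define the `t`-adic topology of `H'`. -/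
def filt (n : ℤ) : Submodule ℂ H' := (tPow n).map constLine.mkQ

/-- The subspace `H'₊ = t ℂ[[t]]` of `H'`. -/
def Hplus : Submodule ℂ H' := filt 1

/-- The representative in `H` with vanishing constant term of a class in `H'`. -/
def sec : H' →ₗ[ℂ] H :=
  constLine.liftQ (LinearMap.id - (coeff 0).smulRight bZero) (by
    intro f hf
    obtain ⟨c, rfl⟩ := Submodule.mem_span_singleton.1 hf
    simp [coeff_bZero])

theorem sec_mk (f : H) : sec (constLine.mkQ f) = f - coeff 0 f • bZero := rfl

theorem mk_bZero : constLine.mkQ bZero = 0 := by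
  rw [← LinearMap.mem_ker, Submodule.ker_mkQ]
  exact bZero_mem

theorem mk_sec (f : H') : constLine.mkQ (sec f) = f := by
  obtain ⟨f, rfl⟩ := constLine.mkQ_surjective f
  rw [sec_mk, map_sub, map_smul, mk_bZero, smul_zero, sub_zero]

theorem coeff_sec (f : H') : coeff 0 (sec f) = 0 := by
  obtain ⟨f, rfl⟩ := constLine.mkQ_surjective f
  rw [sec_mk, map_sub, map_smul, coeff_bZero]
  simp

theorem sub_mem_tPow {f : H} (hf : ∀ m < 0, coeff m f = 0) : f - coeff 0 f • bZero ∈ tPow 1 := by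
  rw [mem_tPow]
  intro m hm
  rw [map_sub, map_smul, coeff_bZero]
  by_cases h : m = 0
  · simp [h]
  · simp [h, hf m (by omega)]

theorem sec_mem_tPow {f : H'} (hf : f ∈ Hplus) : sec f ∈ tPow 1 := by
  obtain ⟨f, hf, rfl⟩ := hf
  exact sub_mem_tPow fun m hm => mem_tPow.1 hf m (by omega)

/-! ### The symplectic group -/

/-- Continuity of a linear endomorphism of `H'` in the `t`-adic topology. -/
def TAdicContinuous (T : H' →ₗ[ℂ] H') : Prop :=
  ∀ n : ℤ, ∃ m : ℤ, filt m ≤ (filt n).comap T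

/-- The group of bicontinuous symplectic automorphisms `ρ` of `H'` with `ρ(H'₊) = H'₊`. -/
def SpFull : Subgroup (H' ≃ₗ[ℂ] H') where
  carrier := {ρ | TAdicContinuous ρ.toLinearMap ∧ TAdicContinuous ρ.symm.toLinearMap ∧
    (∀ f g, form (ρ f) (ρ g) = form f g) ∧ ∀ f, ρ f ∈ Hplus ↔ f ∈ Hplus}
  one_mem' := ⟨fun n => ⟨n, le_rfl⟩, fun n => ⟨n, le_rfl⟩, fun _ _ => rfl, fun _ => Iff.rfl⟩
  mul_mem' := by
    rintro ρ σ ⟨h1, h2, h3, h4⟩ ⟨k1, k2, k3, k4⟩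
    refine ⟨fun n => ?_, fun n => ?_, fun f g => (h3 _ _).trans (k3 _ _),
      fun f => (h4 _).trans (k4 _)⟩
    · obtain ⟨m, hm⟩ := h1 n
      obtain ⟨l, hl⟩ := k1 m
      exact ⟨l, fun f hf => hm (hl hf)⟩
    · obtain ⟨m, hm⟩ := k2 n
      obtain ⟨l, hl⟩ := h2 m
      exact ⟨l, fun f hf => hm (hl hf)⟩
  inv_mem' := by
    rintro ρ ⟨h1, h2, h3, h4⟩
    refine ⟨h2, h1, fun f g => ?_, fun f => ?_⟩
    · have := h3 (ρ.symm f) (ρ.symm g)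
      rw [ρ.apply_symm_apply, ρ.apply_symm_apply] at this
      exact this.symm
    · have := h4 (ρ.symm f)
      rw [ρ.apply_symm_apply] at this
      exact this.symm

/-- The weak operator topology: the coarsest one for which all the matrix coefficients
`ρ ↦ ⟨ρ f, g⟩` are continuous, with the usual topology on `ℂ`. -/
instance : TopologicalSpace SpFull :=
  TopologicalSpace.induced (fun ρ (p : H' × H') => form (ρ.1 p.1) p.2) inferInstance

/-- The group `Sp⁺(H')`: the connected component of the identity. -/
def SpPlus : Set SpFull := connectedComponent 1

/-! ### Extended principally polarized abelian varieties -/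

/-- The orthogonal `F^⊥` in `H'`. -/
def perp (F : Submodule ℂ H') : Submodule ℂ H' := F.orthogonalBilin form

/-- The space `F^⊥ / F` (for `F` isotropic). -/
abbrev Red (F : Submodule ℂ H') : Type := ↥(perp F) ⧸ F.submoduleOf (perp F)

instance (F : Submodule ℂ H') : Module ℝ (Red F) := Module.complexToReal (Red F)

instance (F : Submodule ℂ H') : IsScalarTower ℝ ℂ (Red F) := IsScalarTower.complexToReal

/-- The form induced on `F^⊥ / F`. -/
def redForm (F : Submodule ℂ H') : Red F →ₗ[ℂ] Red F →ₗ[ℂ] ℂ :=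
  (form.domRestrict₁₂ (perp F) (perp F)).liftQ₂ (F.submoduleOf (perp F)) (F.submoduleOf (perp F))
    (fun f hf => LinearMap.ext fun g => g.2 f.1 hf)
    (fun g hg => LinearMap.ext fun f => (form_skew f.1 g.1).trans
      (neg_eq_zero.2 (f.2 g.1 hg)))

/-- The image in `F^⊥ / F` of `F^⊥₊ = F^⊥ ∩ H'₊`. -/
def redPlus (F : Submodule ℂ H') : Submodule ℂ (Red F) :=
  (Hplus.submoduleOf (perp F)).map (F.submoduleOf (perp F)).mkQ

theorem le_perp {F Z : Submodule ℂ H'} (hF : F ≤ Z) (hZ : perp Z = Z) : Z ≤ perp F :=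
  fun _ hf g hg => (hZ.ge hf) g (hF hg)

/-- The map `Z / F → F^⊥ / F` induced by an inclusion `Z ⊆ F^⊥`. -/
def redIncl {F Z : Submodule ℂ H'} (h : Z ≤ perp F) : (↥Z ⧸ F.submoduleOf Z) →ₗ[ℂ] Red F :=
  (F.submoduleOf Z).mapQ (F.submoduleOf (perp F)) (Submodule.inclusion h) (fun _ hf => hf)

/-- `u'` is the conjugate of `u` for the real structure with real part `L_ℝ`, the real span
of `L`. -/
def IsConj {F : Submodule ℂ H'} (L : Submodule ℤ (Red F)) (u u' : Red F) : Prop :=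
  ∃ x ∈ Submodule.span ℝ (L : Set (Red F)), ∃ y ∈ Submodule.span ℝ (L : Set (Red F)),
    u = x + Complex.I • y ∧ u' = x - Complex.I • y

/-- An extended PPAV `(Z, F, L)` of dimension `g`. -/
structure ExtPPAV (g : ℕ) where
  Z : Submodule ℂ H'
  F : Submodule ℂ H'
  F_le : F ≤ Z
  lagrangian : perp Z = Z
  finite : Module.Finite ℂ (↥Z ⧸ F.submoduleOf Z)
  codim : Module.finrank ℂ (↥Z ⧸ F.submoduleOf Z) = g
  L : Submodule ℤ (Red F)
  L_fg : L.FG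
  L_rank : Module.finrank ℤ L = 2 * g
  disjoint_plus : Z ⊓ Hplus = ⊥
  disjoint_real : ∀ x ∈ Submodule.span ℝ (L : Set (Red F)), x ∈ redPlus F → x = 0
  /-- The real structure given by `L_ℝ` takes `Z / F` to `F^⊥₊`. -/
  conj_plus : ∀ u : ↥Z ⧸ F.submoduleOf Z, ∃ u' ∈ redPlus F,
    IsConj L (redIncl (le_perp F_le lagrangian) u) u'
  integral : ∀ l ∈ L, ∀ m ∈ L, ∃ n : ℤ, redForm F l m = 2 * Real.pi * Complex.I * n
  unimodular : ∀ φ : L →ₗ[ℤ] ℤ, ∃! l : L, ∀ m : L,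
    redForm F l.1 m.1 = 2 * Real.pi * Complex.I * (φ m : ℤ)
  /-- Positivity of the form `B(u, v) = ⟨ū, v⟩ / π` on `Z / F`. -/
  positive : ∀ u : ↥Z ⧸ F.submoduleOf Z, u ≠ 0 → ∀ u',
    IsConj L (redIncl (le_perp F_le lagrangian) u) u' →
      0 < ((1 / Real.pi : ℂ) * redForm F u' (redIncl (le_perp F_le lagrangian) u)).re

namespace ExtPPAV

variable {g : ℕ} (a : ExtPPAV g)

/-- The space `Z / F`. -/
abbrev Tangent : Type := ↥a.Z ⧸ a.F.submoduleOf a.Z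

/-- The inclusion `Z / F → F^⊥ / F`. -/
def incl : a.Tangent →ₗ[ℂ] Red a.F := redIncl (le_perp a.F_le a.lagrangian)

end ExtPPAV

/-! ### Principally polarized abelian varieties -/

/-- A principally polarized abelian variety `(X, Θ)`: the complex torus `X = W / Λ` together with a
positive definite Hermitian form `B` (antilinear in the first variable) on `W` whose imaginary part
is integral and unimodular on `Λ`. -/
structure PPAV (W : Type*) [NormedAddCommGroup W] [NormedSpace ℂ W] where
  Λ : Submodule ℤ W
  discrete : DiscreteTopology Λ
  span_top : Submodule.span ℝ (Λ : Set W) = ⊤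
  B : W →ₗ⋆[ℂ] W →ₗ[ℂ] ℂ
  hermitian : ∀ u v, (starRingEnd ℂ) (B u v) = B v u
  positive : ∀ u, u ≠ 0 → 0 < (B u u).re
  integral : ∀ u ∈ Λ, ∀ v ∈ Λ, ∃ n : ℤ, (B u v).im = n
  unimodular : ∀ φ : Λ →ₗ[ℤ] ℤ, ∃! u : Λ, ∀ v : Λ, (B u.1 v.1).im = (φ v : ℤ)

section

variable {W : Type*} [NormedAddCommGroup W] [NormedSpace ℂ W]

namespace PPAV

/-- The underlying complex torus. -/
abbrev X (P : PPAV W) : Type _ := W ⧸ P.Λ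

/-- The space `H⁰(X, Ω¹_X)` of global holomorphic one-forms on `X`. The inverse branches of
`W → X` are the charts of `X`, and the changes of charts are translations, so that a one-form on `X`
is a function from `X` to the dual of `W`; it is holomorphic when its pull-back to `W` is. -/
def OneForms (P : PPAV W) : Submodule ℂ (P.X → (W →L[ℂ] ℂ)) where
  carrier := {η | Differentiable ℂ fun w : W => η (P.Λ.mkQ w)}
  add_mem' h k := Differentiable.add h k
  zero_mem' := differentiable_const _
  smul_mem' c _ h := Differentiable.const_smul h c

/-- The canonical map `T₀ X = W → H⁰(X, Ω¹_X)^*`. -/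
def tangentToDual (P : PPAV W) : W →ₗ[ℂ] Module.Dual ℂ P.OneForms where
  toFun w :=
    { toFun := fun η => η.1 0 w
      map_add' := fun _ _ => rfl
      map_smul' := fun _ _ => rfl }
  map_add' w w' := LinearMap.ext fun η => map_add (η.1 0) w w'
  map_smul' c w := LinearMap.ext fun η => map_smul (η.1 0) c w

end PPAV

/-- A point of `Sp(X, Θ)`, the fiber over `(X, Θ)` of the map from extended PPAVs to PPAVs: an
extended PPAV `a = (Z, F, L)` with an isomorphism from its underlying PPAV to `(X, Θ)`, that is, a
linear isomorphism `Z / F ≅ W` that takes the image of `L` under the projection `F^⊥ / F → Z / F`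
along `F^⊥₊` onto `Λ`, and the Hermitian form `⟨ū, v⟩ / π` to `B`. -/
structure Sp (P : PPAV W) where
  a : ExtPPAV (Module.finrank ℂ W)
  iso : a.Tangent ≃ₗ[ℂ] W
  iso_lattice : ∀ u : a.Tangent, iso u ∈ P.Λ ↔ ∃ p ∈ redPlus a.F, a.incl u + p ∈ a.L
  iso_form : ∀ (u v : a.Tangent) (u' : Red a.F), IsConj a.L (a.incl u) u' →
    P.B (iso u) (iso v) = (1 / Real.pi : ℂ) * redForm a.F u' (a.incl v)

namespace Sp

variable {P : PPAV W}

/-- The composition `Z → Z / F ≅ T₀ X → H⁰(X, Ω¹_X)^*`. -/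
def toDual (x : Sp P) : x.a.Z →ₗ[ℂ] Module.Dual ℂ P.OneForms :=
  P.tangentToDual ∘ₗ x.iso.toLinearMap ∘ₗ (x.a.F.submoduleOf x.a.Z).mkQ

/-- The relation `ρ x = x'` for the action of symplectic automorphisms on `Sp(X, Θ)`. -/
structure Moves (ρ : SpFull) (x x' : Sp P) : Prop where
  map_Z : ∀ f, ρ.1 f ∈ x'.a.Z ↔ f ∈ x.a.Z
  map_F : ∀ f, ρ.1 f ∈ x'.a.F ↔ f ∈ x.a.F
  map_L : ∀ (f : perp x.a.F) (f' : perp x'.a.F), f'.1 = ρ.1 f.1 →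
    ((x'.a.F.submoduleOf _).mkQ f' ∈ x'.a.L ↔ (x.a.F.submoduleOf _).mkQ f ∈ x.a.L)
  map_iso : ∀ (f : x.a.Z) (f' : x'.a.Z), f'.1 = ρ.1 f.1 →
    x'.iso ((x'.a.F.submoduleOf _).mkQ f') = x.iso ((x.a.F.submoduleOf _).mkQ f)

end Sp

end

/-! ### Heisenberg vertex algebras -/

/-- A positive definite even lattice structure on an abelian group `Γ`. -/
structure EvenLattice (Γ : Type*) [AddCommGroup Γ] where
  q : LinearMap.BilinForm ℤ Γ
  symm : ∀ x y, q x y = q y x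
  even : ∀ x, Even (q x x)
  positive : ∀ x, x ≠ 0 → 0 < q x x

/-- The complex vector space `𝔥_Γ = Γ ⊗ ℂ`. -/
abbrev Cartan (Γ : Type*) [AddCommGroup Γ] : Type _ := ℂ ⊗[ℤ] Γ

variable {Γ : Type*} [AddCommGroup Γ] (q : EvenLattice Γ)

/-- The bilinear form on `𝔥_Γ`. -/
def cartanForm : LinearMap.BilinForm ℂ (Cartan Γ) := q.q.baseChange ℂ

theorem cartanForm_symm (x y : Cartan Γ) : cartanForm q x y = cartanForm q y x := by
  induction x using TensorProduct.induction_on with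
  | zero => simp
  | add x x' hx hx' => simp only [map_add, LinearMap.add_apply, hx, hx']
  | tmul a x =>
    induction y using TensorProduct.induction_on with
    | zero => simp
    | add y y' hy hy' => simp only [map_add, LinearMap.add_apply, hy, hy']
    | tmul b y =>
      rw [cartanForm, LinearMap.BilinForm.baseChange_tmul, LinearMap.BilinForm.baseChange_tmul,
        q.symm x y, mul_comm a b]

/-- The cocycle `(A ⊗ f, B ⊗ g) ↦ - (A, B) Res f dg` on `𝔥_Γ((t))`. -/
def loopForm : LinearMap.BilinForm ℂ (Cartan Γ ⊗[ℂ] H) :=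
  LinearMap.BilinForm.tmul (cartanForm q) formH

theorem loopForm_tmul (A B : Cartan Γ) (f g : H) :
    loopForm q (A ⊗ₜ f) (B ⊗ₜ g) = formH f g * cartanForm q A B := rfl

theorem loopForm_skew (x y : Cartan Γ ⊗[ℂ] H) : loopForm q x y = -loopForm q y x := by
  induction x with
  | zero => simp
  | add x x' hx hx' => simp only [map_add, LinearMap.add_apply, hx, hx', neg_add]
  | tmul A f =>
    induction y with
    | zero => simp
    | add y y' hy hy' => simp only [map_add, LinearMap.add_apply, hy, hy', neg_add]
    | tmul B g =>
      rw [loopForm_tmul, loopForm_tmul, formH_skew f g, cartanForm_symm q A B, neg_mul]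

/-- The Heisenberg Lie algebra, the central extension of `𝔥_Γ((t))` by `ℂ 𝟏`; the element `(x, c)`
is `x + c 𝟏`. -/
def Heis (_ : EvenLattice Γ) : Type _ := (Cartan Γ ⊗[ℂ] H) × ℂ

instance : AddCommGroup (Heis q) := inferInstanceAs (AddCommGroup ((Cartan Γ ⊗[ℂ] H) × ℂ))

instance : Module ℂ (Heis q) := inferInstanceAs (Module ℂ ((Cartan Γ ⊗[ℂ] H) × ℂ))

instance : Bracket (Heis q) (Heis q) := ⟨fun x y => ((0, loopForm q x.1 y.1) : _ × ℂ)⟩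

theorem Heis.bracket_def (x y : Heis q) : ⁅x, y⁆ = ((0, loopForm q x.1 y.1) : _ × ℂ) := rfl

instance : LieRing (Heis q) where
  add_lie x y z := by
    refine Prod.ext (add_zero _).symm ?_
    exact LinearMap.map_add₂ (loopForm q) x.1 y.1 z.1
  lie_add x y z := by
    refine Prod.ext (add_zero _).symm ?_
    exact map_add (loopForm q x.1) y.1 z.1
  lie_self x := by
    refine Prod.ext rfl ?_
    exact self_eq_neg.1 (loopForm_skew q x.1 x.1)
  leibniz_lie x y z := by
    refine Prod.ext (add_zero _).symm ?_
    change loopForm q x.1 0 = loopForm q 0 z.1 + loopForm q y.1 0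
    simp

instance : LieAlgebra ℂ (Heis q) where
  lie_smul c x y := by
    refine Prod.ext (smul_zero c).symm ?_
    exact map_smul (loopForm q x.1) c y.1

/-- The inclusion of vector spaces `𝔥_Γ((t)) → 𝔥̂_Γ`. -/
def Heis.loop : Cartan Γ ⊗[ℂ] H →ₗ[ℂ] Heis q := LinearMap.inl ℂ (Cartan Γ ⊗[ℂ] H) ℂ

/-- The central element `𝟏`. -/
def Heis.central : Heis q := ((0, 1) : (Cartan Γ ⊗[ℂ] H) × ℂ)

/-- The universal enveloping algebra of the Heisenberg Lie algebra. -/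
abbrev Env : Type _ := UniversalEnvelopingAlgebra ℂ (Heis q)

/-- The left ideal generated by `𝔥_Γ[[t]]` and `𝟏 - ℓ`. -/
def vacIdeal (ℓ : ℂ) : Submodule (Env q) (Env q) :=
  Submodule.span (Env q)
    ({u | ∃ (A : Cartan Γ) (f : H), f ∈ tPow 0 ∧
        u = UniversalEnvelopingAlgebra.ι ℂ (Heis.loop q (A ⊗ₜ f))} ∪
      {UniversalEnvelopingAlgebra.ι ℂ (Heis.central q) - algebraMap ℂ (Env q) ℓ})

/-- The Heisenberg vertex algebra `π_Γ^ℓ` of level `ℓ`, as a representation of the Heisenberg Lie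
algebra: it is induced from the one-dimensional representation of `𝔥_Γ[[t]] ⊕ ℂ 𝟏` on which
`𝔥_Γ[[t]]` acts by `0` and `𝟏` acts by `ℓ`. -/
abbrev Fock (ℓ : ℂ) : Type _ := Env q ⧸ vacIdeal q ℓ

/-- The vacuum vector. -/
def vac (ℓ : ℂ) : Fock q ℓ := (vacIdeal q ℓ).mkQ 1

/-- The element `A ⊗ f` for `f ∈ H'`. A class in `H'` is represented by the series without constant
term; the elements `A ⊗ b₀` are central and act by `0` on the Fock representations. -/
def mode (A : Cartan Γ) (f : H') : Env q :=
  UniversalEnvelopingAlgebra.ι ℂ (Heis.loop q (A ⊗ₜ sec f))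

/-- The vector `(A₁ ⊗ f₁) ⋯ (A_k ⊗ f_k) 𝟏` of the Fock representation. -/
def monomial (ℓ : ℂ) (l : List (Cartan Γ × H')) : Fock q ℓ :=
  (l.map fun p => mode q p.1 p.2).prod • vac q ℓ

/-! ### The action of the symplectic group -/

/-- The lift of `ρ` to `H` that preserves constant terms. -/
def liftH (ρ : SpFull) : H →ₗ[ℂ] H :=
  sec ∘ₗ ρ.1.toLinearMap ∘ₗ constLine.mkQ + (coeff 0).smulRight bZero

theorem liftH_apply (ρ : SpFull) (f : H) :
    liftH ρ f = sec (ρ.1 (constLine.mkQ f)) + coeff 0 f • bZero := rfl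

theorem mk_liftH (ρ : SpFull) (f : H) :
    constLine.mkQ (liftH ρ f) = ρ.1 (constLine.mkQ f) := by
  rw [liftH_apply, map_add, mk_sec, map_smul, mk_bZero, smul_zero, add_zero]

theorem liftH_sec (ρ : SpFull) (f : H') : liftH ρ (sec f) = sec (ρ.1 f) := by
  rw [liftH_apply, mk_sec, coeff_sec, zero_smul, add_zero]

theorem formH_liftH (ρ : SpFull) (f g : H) : formH (liftH ρ f) (liftH ρ g) = formH f g := by
  rw [← form_mk, mk_liftH, mk_liftH, ρ.2.2.2.1, form_mk]

theorem liftH_mem (ρ : SpFull) {f : H} (hf : f ∈ tPow 0) : liftH ρ f ∈ tPow 0 := by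
  have h1 : constLine.mkQ f ∈ Hplus := by
    refine ⟨_, sub_mem_tPow (mem_tPow.1 hf), ?_⟩
    rw [← sec_mk, mk_sec]
  have h2 := mem_tPow.1 (sec_mem_tPow ((ρ.2.2.2.2 _).2 h1))
  rw [mem_tPow]
  intro m hm
  rw [liftH_apply, map_add, h2 m (by omega), map_smul, coeff_bZero]
  simp [hm.ne]

theorem loopForm_liftH (ρ : SpFull) (x y : Cartan Γ ⊗[ℂ] H) :
    loopForm q ((liftH ρ).lTensor (Cartan Γ) x) ((liftH ρ).lTensor (Cartan Γ) y) =
      loopForm q x y := by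
  induction x with
  | zero => simp
  | add x x' hx hx' => simp only [map_add, LinearMap.add_apply, hx, hx']
  | tmul A f =>
    induction y with
    | zero => simp
    | add y y' hy hy' => simp only [map_add, hy, hy']
    | tmul B g =>
      rw [LinearMap.lTensor_tmul, LinearMap.lTensor_tmul, loopForm_tmul, loopForm_tmul,
        formH_liftH]

/-- The automorphism `A ⊗ f ↦ A ⊗ ρ f`, `𝟏 ↦ 𝟏` of the Heisenberg Lie algebra. -/
def heisHom (ρ : SpFull) : Heis q →ₗ⁅ℂ⁆ Heis q where
  toLinearMap := ((liftH ρ).lTensor (Cartan Γ)).prodMap (LinearMap.id : ℂ →ₗ[ℂ] ℂ)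
  map_lie' {x y} := by
    refine Prod.ext (map_zero ((liftH ρ).lTensor (Cartan Γ))) ?_
    exact (loopForm_liftH q ρ x.1 y.1).symm

theorem heisHom_loop (ρ : SpFull) (A : Cartan Γ) (f : H) :
    heisHom q ρ (Heis.loop q (A ⊗ₜ f)) = Heis.loop q (A ⊗ₜ liftH ρ f) := rfl

theorem heisHom_central (ρ : SpFull) : heisHom q ρ (Heis.central q) = Heis.central q :=
  Prod.ext (map_zero ((liftH ρ).lTensor (Cartan Γ))) rfl

attribute [local instance] LieRing.ofAssociativeRing

/-- The induced endomorphism of the enveloping algebra. -/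
def envHom (ρ : SpFull) : Env q →ₐ[ℂ] Env q :=
  UniversalEnvelopingAlgebra.lift ℂ ((UniversalEnvelopingAlgebra.ι ℂ).comp (heisHom q ρ))

theorem envHom_ι (ρ : SpFull) (x : Heis q) :
    envHom q ρ (UniversalEnvelopingAlgebra.ι ℂ x) =
      UniversalEnvelopingAlgebra.ι ℂ (heisHom q ρ x) := by
  rw [envHom, UniversalEnvelopingAlgebra.lift_ι_apply]
  rfl

theorem envHom_mode (ρ : SpFull) (A : Cartan Γ) (f : H') :
    envHom q ρ (mode q A f) = mode q A (ρ.1 f) := by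
  rw [mode, envHom_ι, heisHom_loop, liftH_sec]
  rfl

theorem envHom_vacIdeal (ρ : SpFull) (ℓ : ℂ) {u : Env q} (hu : u ∈ vacIdeal q ℓ) :
    envHom q ρ u ∈ vacIdeal q ℓ := by
  induction hu using Submodule.span_induction with
  | zero => rw [map_zero]; exact Submodule.zero_mem _
  | add x y _ _ hx hy => rw [map_add]; exact Submodule.add_mem _ hx hy
  | smul c x _ hx => rw [smul_eq_mul, map_mul]; exact Submodule.smul_mem _ _ hx
  | mem x hx =>
    apply Submodule.subset_span
    rcases hx with ⟨A, f, hf, rfl⟩ | hx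
    · exact Or.inl ⟨A, liftH ρ f, liftH_mem ρ hf, by rw [envHom_ι, heisHom_loop]⟩
    · rw [Set.mem_singleton_iff.1 hx]
      refine Or.inr ?_
      rw [map_sub, envHom_ι, heisHom_central, AlgHom.commutes]
      rfl

/-- The action of `ρ` on the Fock representation: it fixes the vacuum and satisfies
`ρ ∘ (A ⊗ f) = (A ⊗ ρ f) ∘ ρ`. -/
def fockMap (ρ : SpFull) (ℓ : ℂ) : Fock q ℓ →ₗ[ℂ] Fock q ℓ :=
  ((vacIdeal q ℓ).restrictScalars ℂ).mapQ ((vacIdeal q ℓ).restrictScalars ℂ)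
    (envHom q ρ).toLinearMap (fun _ hu => envHom_vacIdeal q ρ ℓ hu)

theorem fockMap_vac (ρ : SpFull) (ℓ : ℂ) : fockMap q ρ ℓ (vac q ℓ) = vac q ℓ :=
  congrArg (vacIdeal q ℓ).mkQ (map_one (envHom q ρ))

theorem fockMap_smul (ρ : SpFull) (ℓ : ℂ) (u : Env q) (v : Fock q ℓ) :
    fockMap q ρ ℓ (u • v) = envHom q ρ u • fockMap q ρ ℓ v := by
  obtain ⟨w, rfl⟩ := (vacIdeal q ℓ).mkQ_surjective v
  exact congrArg (vacIdeal q ℓ).mkQ (map_mul (envHom q ρ) u w)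

/-! ### Coinvariants -/

/-- The subspace `𝔥^out(V)` of `V = π_Γ^ℓ`, for `𝔥^out = 𝔥_Γ ⊗ F`. -/
def outSub (ℓ : ℂ) (F : Submodule ℂ H') : Submodule ℂ (Fock q ℓ) :=
  Submodule.span ℂ {v | ∃ (A : Cartan Γ) (f : H') (w : Fock q ℓ), f ∈ F ∧ v = mode q A f • w}

/-- The space of coinvariants `V / 𝔥^out(V)` at an extended PPAV `(Z, F, L)`. -/
abbrev ExtCoinv (ℓ : ℂ) (F : Submodule ℂ H') : Type _ := Fock q ℓ ⧸ outSub q ℓ F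

/-- The map on coinvariants induced by an automorphism `ρ` that takes `F` to `F'`. -/
def coinvMap (ρ : SpFull) (ℓ : ℂ) {F F' : Submodule ℂ H'} (h : ∀ f, ρ.1 f ∈ F' ↔ f ∈ F) :
    ExtCoinv q ℓ F →ₗ[ℂ] ExtCoinv q ℓ F' :=
  (outSub q ℓ F).mapQ (outSub q ℓ F') (fockMap q ρ ℓ) (by
    refine Submodule.span_le.2 ?_
    rintro _ ⟨A, f, w, hf, rfl⟩
    refine Submodule.subset_span ⟨A, ρ.1 f, fockMap q ρ ℓ w, (h f).2 hf, ?_⟩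
    rw [fockMap_smul, envHom_mode])

/-- The space of coinvariants `𝕍(X, Θ, π_Γ^ℓ)`, obtained by descent along `Sp(X, Θ)`: the space of
the `Sp⁺(H')`-invariant sections of the family with fibers the coinvariants at the points of the
homogeneous space `Sp(X, Θ)`. -/
def Coinv (ℓ : ℂ) {W : Type*} [NormedAddCommGroup W] [NormedSpace ℂ W] (P : PPAV W) :
    Submodule ℂ (∀ x : Sp P, ExtCoinv q ℓ x.a.F) where
  carrier := {v | ∀ ρ ∈ SpPlus, ∀ (x x' : Sp P) (h : Sp.Moves ρ x x'),
    coinvMap q ρ ℓ h.map_F (v x) = v x'}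
  add_mem' hv hw ρ hρ x x' h := by
    simp only [Pi.add_apply, map_add, hv ρ hρ x x' h, hw ρ hρ x x' h]
  zero_mem' ρ hρ x x' h := by simp only [Pi.zero_apply, map_zero]
  smul_mem' c v hv ρ hρ x x' h := by
    simp only [Pi.smul_apply, map_smul, hv ρ hρ x x' h]

/-! ### Polynomial functions -/

/-- The ring of polynomial functions on a complex vector space: the algebra of functions generated
by the linear forms. -/
def Fun (E : Type*) [AddCommGroup E] [Module ℂ E] : Subalgebra ℂ (E → ℂ) :=
  Algebra.adjoin ℂ {φ | ∃ ψ : Module.Dual ℂ E, φ = ψ}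

/-- The pairing of `𝔥_Γ ⊗ H⁰(X, Ω¹)^*` with `𝔥_Γ ⊗ H⁰(X, Ω¹)` given by
`(A ⊗ u, B ⊗ η) ↦ (A, B) u(η)`, for fixed `A` and `u`. -/
def pairing {M : Type*} [AddCommMonoid M] [Module ℂ M] (A : Cartan Γ) (u : Module.Dual ℂ M) :
    Cartan Γ ⊗[ℂ] M →ₗ[ℂ] ℂ :=
  LinearMap.mul' ℂ ℂ ∘ₗ TensorProduct.map (cartanForm q A) u

end AbelianCoinvariants

end

open AbelianCoinvariants

/-!
The form identifies `H'₊` with the full linear dual of any Lagrangian complement `Z`. A point of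
`Sp(X, Θ)` amounts to such a `Z` together with a surjection `p : Z → W`: then `F = ker p`, and `L`
is recovered from `Λ`, because the conjugate `w̄ ∈ F^⊥₊` of `w` is determined by
`⟨w̄, z⟩ = π B(w, p z)`.

An element `1 + T` of the symplectic group with `T² = 0` is joined to the identity by the line
`1 + s T`, so it lies in the identity component. Such elements act transitively on the pairs
`(Z, p)`: one of them slides `Z` along `H'₊` onto any other complement, and those of the form
`N ⊕ -N*` on `Z ⊕ H'₊` change the surjection, two surjections being compared through a common
right inverse. This gives the injectivity of the evaluations.

At level zero the modes commute and those in `𝔥 ⊗ H'₊` act on the vacuum by zero, so the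
coinvariants at a point are `Sym(𝔥 ⊗ H' / (F + H'₊)) = Sym(𝔥 ⊗ Z / F) = Sym(𝔥 ⊗ H⁰(X, Ω¹)^*)`.
The last identification is compatible with the symplectic moves, hence a vector at one point
extends to a family.
-/

noncomputable section

namespace AbelianCoinvariants

/-! ### Lagrangian complements of `H'₊` -/

/-- The Laurent monomial `t ^ m`. -/
def singleH (m : ℤ) : H := HahnSeries.single m (1 : ℂ)

theorem coeff_singleH (n m : ℤ) : coeff n (singleH m) = if n = m then 1 else 0 := by
  classical
  exact HahnSeries.coeff_single.trans (by congr)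

/-- The class of `t ^ m` in `H'`; it vanishes for `m = 0`. -/
def single (m : ℤ) : H' := constLine.mkQ (singleH m)

theorem coeff_sec_single (n m : ℤ) :
    coeff n (sec (single m)) = if n = m ∧ n ≠ 0 then 1 else 0 := by
  rw [single, sec_mk, map_sub, map_smul, coeff_singleH, coeff_singleH, coeff_bZero, smul_eq_mul]
  grind

theorem single_zero : single 0 = 0 := mk_bZero

theorem form_eq_formH_sec (x y : H') : form x y = formH (sec x) (sec y) := by
  rw [← form_mk, mk_sec, mk_sec]

theorem form_single (x : H') (m : ℤ) : form x (single m) = -(m * coeff (-m) (sec x)) := by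
  rw [form_eq_formH_sec, formH_eq_finsum, finsum_eq_single _ m]
  · rcases eq_or_ne m 0 with rfl | hm <;> simp [coeff_sec_single, *]
  · intro n hn
    simp [coeff_sec_single, hn]

theorem form_eq_zero_of_coeff {x y : H'}
    (h : ∀ n : ℤ, coeff (-n) (sec x) = 0 ∨ coeff n (sec y) = 0) : form x y = 0 := by
  rw [form_eq_formH_sec, formH_eq_finsum, neg_eq_zero]
  refine (finsum_congr fun n => ?_).trans finsum_zero
  rcases h n with h | h <;> simp [h]

theorem eq_zero_of_form_eq_zero {x : H'} (h : ∀ y, form x y = 0) : x = 0 := by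
  have hsec : sec x = 0 := HahnSeries.ext <| funext fun n => by
    change coeff n (sec x) = 0
    rcases eq_or_ne n 0 with rfl | hn
    · exact coeff_sec x
    · simpa [form_single, hn] using h (single (-n))
  rw [← mk_sec x, hsec, map_zero]

theorem mem_filt_iff {n : ℤ} (hn : 1 ≤ n) {x : H'} :
    x ∈ filt n ↔ ∀ m < n, coeff m (sec x) = 0 := by
  refine ⟨?_, fun h => ⟨sec x, mem_tPow.2 h, mk_sec x⟩⟩
  rintro ⟨f, hf, rfl⟩ m hm
  rw [sec_mk, map_sub, map_smul, mem_tPow.1 hf m hm, mem_tPow.1 hf 0 (by omega), zero_smul,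
    sub_zero]

theorem filt_anti {m n : ℤ} (h : m ≤ n) : filt n ≤ filt m :=
  Submodule.map_mono fun _ hf => mem_tPow.2 fun k hk => mem_tPow.1 hf k (hk.trans_le h)

theorem form_eq_zero_of_mem_Hplus {x y : H'} (hx : x ∈ Hplus) (hy : y ∈ Hplus) :
    form x y = 0 := by
  refine form_eq_zero_of_coeff fun n => ?_
  rcases lt_or_ge n 1 with h | h
  · exact Or.inr ((mem_filt_iff le_rfl).1 hy n h)
  · exact Or.inl ((mem_filt_iff le_rfl).1 hx (-n) (by omega))

theorem exists_mem_tPow (f : H) : ∃ N : ℕ, f ∈ tPow (1 - N) := by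
  refine ⟨(1 - HahnSeries.order (f : LaurentSeries ℂ)).toNat, mem_tPow.2 fun m hm => ?_⟩
  by_contra h
  have := HahnSeries.order_le_of_coeff_ne_zero (x := (f : LaurentSeries ℂ)) h
  omega

/-- The standard Lagrangian complement `t⁻¹ ℂ[t⁻¹]` of `H'₊`. -/
def Hminus : Submodule ℂ H' := Submodule.span ℂ (Set.range fun n : ℕ => single (-n))

theorem single_mem_Hminus (n : ℕ) : single (-n) ∈ Hminus := Submodule.subset_span ⟨n, rfl⟩

theorem mkQ_mem_Hminus_sup_Hplus (N : ℕ) {f : H} (hf : f ∈ tPow (1 - N)) :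
    constLine.mkQ f ∈ Hminus ⊔ Hplus := by
  induction N generalizing f with
  | zero => exact Submodule.mem_sup_right ⟨f, by simpa using hf, rfl⟩
  | succ N ih =>
    have hrest : f - coeff (-N) f • singleH (-N) ∈ tPow (1 - N) := mem_tPow.2 fun m hm => by
      rw [map_sub, map_smul, coeff_singleH]
      rcases eq_or_ne m (-N) with rfl | h
      · simp
      · rw [if_neg h, smul_zero, sub_zero]
        exact mem_tPow.1 hf m (by push_cast; omega)
    have hpole : coeff (-N) f • single (-N) ∈ Hminus ⊔ Hplus :=
      Submodule.smul_mem _ _ (Submodule.mem_sup_left (single_mem_Hminus N))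
    have hadd := Submodule.add_mem _ (ih hrest) hpole
    rwa [map_sub, map_smul, ← single, sub_add_cancel] at hadd

theorem codisjoint_Hminus_Hplus : Codisjoint Hminus Hplus := by
  refine codisjoint_iff.2 (eq_top_iff.2 fun x _ => ?_)
  obtain ⟨N, hN⟩ := exists_mem_tPow (sec x)
  exact mk_sec x ▸ mkQ_mem_Hminus_sup_Hplus N hN

theorem form_eq_zero_of_mem_Hminus {x y : H'} (hx : x ∈ Hminus) (hy : y ∈ Hminus) :
    form x y = 0 := by
  have hsingle (n k : ℕ) : form (single (-n)) (single (-k)) = 0 := by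
    rcases k with _ | k
    · simp [single_zero]
    · rw [form_single, coeff_sec_single, if_neg (by omega), mul_zero, neg_zero]
  induction hx, hy using Submodule.span_induction₂ with
  | mem_mem x y hx hy =>
    obtain ⟨⟨n, rfl⟩, k, rfl⟩ := And.intro hx hy
    exact hsingle n k
  | zero_left y => simp
  | zero_right x => simp
  | add_left x y z _ _ _ hx hy => simp [hx, hy]
  | add_right x y z _ _ _ hx hy => simp [hx, hy]
  | smul_left r x y _ _ h => simp [h]
  | smul_right r x y _ _ h => simp [h]

theorem exists_mem_Hplus_form_eq (φ : Module.Dual ℂ H') (hφ : ∀ x ∈ Hplus, φ x = 0) :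
    ∃ h ∈ Hplus, form h = φ := by
  -- The coefficients are forced by `⟨t ^ n, t ^ (-n)⟩ = n`.
  let c : ℤ → ℂ := fun n => if n < 1 then 0 else φ (single (-n)) / n
  let f : H := HahnSeries.ofSuppBddBelow c ⟨1, fun n hn => not_lt.1 fun h => hn (if_pos h)⟩
  have hf : f ∈ tPow 1 := mem_tPow.2 fun m hm => if_pos hm
  have hcoeff (n : ℤ) (hn : n ≠ 0) : coeff n (sec (constLine.mkQ f)) = c n := by
    rw [sec_mk, map_sub, map_smul, coeff_bZero, if_neg hn, smul_zero, sub_zero]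
    rfl
  have hmem : constLine.mkQ f ∈ Hplus := ⟨f, hf, rfl⟩
  refine ⟨_, hmem, LinearMap.ext_on_codisjoint codisjoint_Hminus_Hplus ?_ fun x hx => ?_⟩
  · refine LinearMap.eqOn_span ?_
    rintro _ ⟨n, rfl⟩
    rcases eq_or_ne n 0 with rfl | hn
    · simp [single_zero]
    · have h1 : ¬ (n : ℤ) < 1 := by omega
      have h2 : (n : ℂ) ≠ 0 := by exact_mod_cast hn
      simp only [form_single, neg_neg, hcoeff n (by omega), c, if_neg h1]
      push_cast
      field_simp
  · rw [form_eq_zero_of_mem_Hplus hmem hx, hφ x hx]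

/-- `Z` is a Lagrangian subspace of `H'` complementary to `H'₊`. -/
structure IsLagrangianComplement (Z : Submodule ℂ H') : Prop where
  perp_eq : perp Z = Z
  inf_eq_bot : Z ⊓ Hplus = ⊥

theorem eq_zero_of_codisjoint {Z : Submodule ℂ H'} (hZ : Codisjoint Z Hplus) {h : H'}
    (hh : h ∈ Hplus) (h0 : ∀ z ∈ Z, form h z = 0) : h = 0 := by
  have hform : form h = 0 := LinearMap.ext_on_codisjoint hZ h0 fun x hx =>
    form_eq_zero_of_mem_Hplus hh hx
  exact eq_zero_of_form_eq_zero fun y => by rw [hform, LinearMap.zero_apply]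

theorem isLagrangianComplement_Hminus : IsLagrangianComplement Hminus where
  perp_eq := by
    refine le_antisymm (fun x hx => ?_) fun x hx y hy => form_eq_zero_of_mem_Hminus hy hx
    obtain ⟨y, h, hy, hh, rfl⟩ := Submodule.codisjoint_iff_exists_add_eq.1 codisjoint_Hminus_Hplus x
    suffices h = 0 by rwa [this, add_zero]
    refine eq_zero_of_codisjoint codisjoint_Hminus_Hplus hh fun z hz => ?_
    have hzyh : form z (y + h) = 0 := hx z hz
    rwa [map_add, form_eq_zero_of_mem_Hminus hz hy, zero_add, form_skew, neg_eq_zero] at hzyh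
  inf_eq_bot := (Submodule.eq_bot_iff _).2 fun _ hx =>
    eq_zero_of_codisjoint codisjoint_Hminus_Hplus hx.2 fun _ => form_eq_zero_of_mem_Hminus hx.1

namespace IsLagrangianComplement

variable {Z : Submodule ℂ H'}

theorem form_eq_zero (hZ : IsLagrangianComplement Z) {x y : H'} (hx : x ∈ Z) (hy : y ∈ Z) :
    form x y = 0 :=
  (hZ.perp_eq.ge hy) x hx

theorem eq_zero_of_form_eq_zero (hZ : IsLagrangianComplement Z) {h : H'} (hh : h ∈ Hplus)
    (h0 : ∀ z ∈ Z, form h z = 0) : h = 0 := by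
  have hmem : h ∈ Z := hZ.perp_eq.le fun z hz => by
    change form z h = 0
    rw [form_skew, h0 z hz, neg_zero]
  exact (Submodule.eq_bot_iff _).1 hZ.inf_eq_bot h ⟨hmem, hh⟩

theorem isCompl (hZ : IsLagrangianComplement Z) : IsCompl Z Hplus := by
  refine ⟨disjoint_iff.2 hZ.inf_eq_bot, codisjoint_iff.2 (eq_top_iff.2 fun x _ => ?_)⟩
  by_contra hx
  obtain ⟨φ, hφx, hφ⟩ := Submodule.exists_le_ker_of_notMem hx
  obtain ⟨h, hh, rfl⟩ := exists_mem_Hplus_form_eq φ fun y hy => hφ (Submodule.mem_sup_right hy)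
  have h0 : h = 0 := hZ.eq_zero_of_form_eq_zero hh fun z hz => hφ (Submodule.mem_sup_left hz)
  exact hφx (by rw [h0, map_zero, LinearMap.zero_apply])

/-- The identification of `H'₊` with the dual of a Lagrangian complement given by the form. -/
def dualEquiv (hZ : IsLagrangianComplement Z) : Hplus ≃ₗ[ℂ] Module.Dual ℂ Z :=
  LinearEquiv.ofBijective (form.domRestrict₁₂ Hplus Z) (by
    refine ⟨(injective_iff_map_eq_zero _).2 fun h hh => Subtype.ext ?_, fun φ => ?_⟩
    · exact hZ.eq_zero_of_form_eq_zero h.2 fun z hz => LinearMap.congr_fun hh ⟨z, hz⟩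
    · obtain ⟨h, hh, hφ⟩ := exists_mem_Hplus_form_eq (φ ∘ₗ Z.projectionOnto Hplus hZ.isCompl)
        fun x hx => by
          rw [LinearMap.comp_apply, (Submodule.projectionOnto_apply_eq_zero_iff _).2 hx, map_zero]
      refine ⟨⟨h, hh⟩, LinearMap.ext fun z => (LinearMap.congr_fun hφ z.1).trans ?_⟩
      rw [LinearMap.comp_apply, Submodule.projectionOnto_apply_left])

theorem form_dualEquiv_symm (hZ : IsLagrangianComplement Z) (φ : Module.Dual ℂ Z) (z : Z) :
    form (hZ.dualEquiv.symm φ).1 z.1 = φ z :=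
  LinearMap.congr_fun (hZ.dualEquiv.apply_symm_apply φ) z

end IsLagrangianComplement

/-! ### Unipotent elements of the identity component -/

theorem mem_filt_of_form_eq_zero {n : ℕ} {x : H'} (hx : x ∈ Hplus)
    (h : ∀ k < n, form x (single (-k)) = 0) : x ∈ filt n := by
  refine ⟨sec x, mem_tPow.2 fun m hm => ?_, mk_sec x⟩
  rcases lt_or_ge m 1 with h1 | h1
  · exact (mem_filt_iff le_rfl).1 hx m h1
  · lift m to ℕ using by omega
    have hm0 : m ≠ 0 := by omega
    simpa [form_single, hm0] using h m (by exact_mod_cast hm)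

theorem exists_form_eq_zero_of_mem_filt (y : H') : ∃ m : ℕ, ∀ x ∈ filt m, form x y = 0 := by
  obtain ⟨N, hN⟩ := exists_mem_tPow (sec y)
  refine ⟨N + 1, fun x hx => form_eq_zero_of_coeff fun n => ?_⟩
  rcases lt_or_ge n (1 - N) with h | h
  · exact Or.inr (mem_tPow.1 hN n h)
  · exact Or.inl ((mem_filt_iff (by omega)).1 hx _ (by push_cast; omega))

theorem tAdicContinuous_of_skew {T : H' →ₗ[ℂ] H'} (hskew : ∀ x y, form (T x) y = -form x (T y))
    (hplus : ∀ x ∈ Hplus, T x ∈ Hplus) : TAdicContinuous T := by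
  intro n
  choose m hm using fun k : ℕ => exists_form_eq_zero_of_mem_filt (T (single (-k)))
  refine ⟨max 1 ((Finset.range n.toNat).sup m : ℕ), fun x hx => ?_⟩
  refine filt_anti (Int.self_le_toNat n) (mem_filt_of_form_eq_zero
    (hplus x (filt_anti (le_max_left _ _) hx)) fun k hk => ?_)
  have hle : m k ≤ (Finset.range n.toNat).sup m := Finset.le_sup (Finset.mem_range.2 hk)
  rw [hskew, hm k x (filt_anti (le_max_of_le_right (by exact_mod_cast hle)) hx), neg_zero]

theorem TAdicContinuous.id_add_smul {T : H' →ₗ[ℂ] H'} (hT : TAdicContinuous T) (c : ℂ) :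
    TAdicContinuous (LinearMap.id + c • T) := by
  intro n
  obtain ⟨m, hm⟩ := hT n
  refine ⟨max m n, fun x hx => Submodule.add_mem _ (filt_anti (le_max_right m n) hx) ?_⟩
  exact Submodule.smul_mem _ c (hm (filt_anti (le_max_left m n) hx))

/-- `T` is a square-zero element of the Lie algebra of the symplectic group of `H'` that preserves
`H'₊`; the one-parameter group which it generates consists of the automorphisms `1 + c T`. -/
structure IsSquareZeroSp (T : H' →ₗ[ℂ] H') : Prop where
  skew : ∀ x y, form (T x) y = -form x (T y)
  sq_eq_zero : ∀ x, T (T x) = 0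
  map_Hplus : ∀ x ∈ Hplus, T x ∈ Hplus

namespace IsSquareZeroSp

variable {T : H' →ₗ[ℂ] H'}

/-- The automorphism `1 + c T`. -/
def equiv (hT : IsSquareZeroSp T) (c : ℂ) : H' ≃ₗ[ℂ] H' :=
  LinearEquiv.ofLinearMap (LinearMap.id + c • T) (LinearMap.id + (-c) • T)
    (LinearMap.ext fun x => by simp [hT.sq_eq_zero])
    (LinearMap.ext fun x => by simp [hT.sq_eq_zero])

theorem equiv_apply (hT : IsSquareZeroSp T) (c : ℂ) (x : H') : hT.equiv c x = x + c • T x := rfl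

theorem equiv_mem_SpFull (hT : IsSquareZeroSp T) (c : ℂ) : hT.equiv c ∈ SpFull := by
  have hcont := tAdicContinuous_of_skew hT.skew hT.map_Hplus
  have hplus (c : ℂ) (x : H') (hx : x ∈ Hplus) : x + c • T x ∈ Hplus :=
    Submodule.add_mem _ hx (Submodule.smul_mem _ c (hT.map_Hplus x hx))
  refine ⟨hcont.id_add_smul c, hcont.id_add_smul (-c), fun x y => ?_, fun x => ⟨fun hx => ?_,
    hplus c x⟩⟩
  · simp [equiv_apply, hT.skew x, hT.sq_eq_zero]
  · simpa [equiv_apply, hT.sq_eq_zero] using hplus (-c) _ hx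

/-- The one-parameter group `c ↦ 1 + c T` in the symplectic group. -/
def toSp (hT : IsSquareZeroSp T) (c : ℂ) : SpFull := ⟨hT.equiv c, hT.equiv_mem_SpFull c⟩

theorem toSp_apply (hT : IsSquareZeroSp T) (c : ℂ) (x : H') : (hT.toSp c).1 x = x + c • T x := rfl

theorem continuous_toSp (hT : IsSquareZeroSp T) : Continuous hT.toSp := by
  refine continuous_induced_rng.2 (continuous_pi fun p => ?_)
  change Continuous fun c => form ((hT.toSp c).1 p.1) p.2
  simp only [toSp_apply, map_add, map_smul, LinearMap.add_apply, LinearMap.smul_apply, smul_eq_mul]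
  fun_prop

theorem toSp_mem_SpPlus (hT : IsSquareZeroSp T) (c : ℂ) : hT.toSp c ∈ SpPlus := by
  refine (isPreconnected_range hT.continuous_toSp).subset_connectedComponent ⟨0, ?_⟩ ⟨c, rfl⟩
  exact Subtype.ext (LinearEquiv.ext fun x => by simp [toSp_apply])

end IsSquareZeroSp

theorem continuous_mul_right_SpFull (σ : SpFull) : Continuous fun τ : SpFull => τ * σ := by
  have hform : Continuous fun (τ : SpFull) (p : H' × H') => form (τ.1 p.1) p.2 :=
    continuous_induced_dom
  exact continuous_induced_rng.2
    (continuous_pi fun p => (continuous_apply (σ.1 p.1, p.2)).comp hform)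

theorem mul_mem_SpPlus {ρ σ : SpFull} (hρ : ρ ∈ SpPlus) (hσ : σ ∈ SpPlus) : ρ * σ ∈ SpPlus := by
  have himage := (isPreconnected_connectedComponent (x := (1 : SpFull))).image _
    (continuous_mul_right_SpFull σ).continuousOn
  have hsub := himage.subset_connectedComponent (x := σ) ⟨1, mem_connectedComponent, one_mul σ⟩
  rw [← connectedComponent_eq hσ] at hsub
  exact hsub ⟨ρ, hρ, rfl⟩

/-! ### Transitivity -/

namespace IsLagrangianComplement

variable {Z Z' : Submodule ℂ H'}

theorem isSquareZeroSp_projection_sub (hZ : IsLagrangianComplement Z)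
    (hZ' : IsLagrangianComplement Z') :
    IsSquareZeroSp (Z'.projection Hplus hZ'.isCompl - Z.projection Hplus hZ.isCompl) := by
  set π := Z.projection Hplus hZ.isCompl
  set π' := Z'.projection Hplus hZ'.isCompl
  have hsub (x : H') : x - π x ∈ Hplus := Submodule.sub_projection_mem hZ.isCompl x
  have hsub' (x : H') : x - π' x ∈ Hplus := Submodule.sub_projection_mem hZ'.isCompl x
  have hmem (x : H') : (π' - π) x ∈ Hplus := by
    simpa using Submodule.sub_mem _ (hsub x) (hsub' x)
  refine ⟨fun x y => ?_, fun x => ?_, fun x _ => hmem x⟩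
  · have h1 := form_eq_zero_of_mem_Hplus (hmem x) (hsub y)
    have h2 := form_eq_zero_of_mem_Hplus (hsub' x) (hmem y)
    have h3 : form (π x) (π y) = 0 := hZ.form_eq_zero
      (Submodule.projection_apply_mem _ x) (Submodule.projection_apply_mem _ y)
    have h4 : form (π' x) (π' y) = 0 := hZ'.form_eq_zero
      (Submodule.projection_apply_mem _ x) (Submodule.projection_apply_mem _ y)
    simp only [map_sub, LinearMap.sub_apply] at h1 h2 ⊢
    linear_combination h1 + h2 + h4 - h3
  · rw [LinearMap.sub_apply, Submodule.projection_apply_of_mem_right hZ'.isCompl (hmem x),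
      Submodule.projection_apply_of_mem_right hZ.isCompl (hmem x), sub_zero]

theorem exists_mapsTo (hZ : IsLagrangianComplement Z) (hZ' : IsLagrangianComplement Z') :
    ∃ ρ ∈ SpPlus, ∀ z ∈ Z, ρ.1 z ∈ Z' := by
  refine ⟨_, (hZ.isSquareZeroSp_projection_sub hZ').toSp_mem_SpPlus 1, fun z hz => ?_⟩
  rw [IsSquareZeroSp.toSp_apply, one_smul, LinearMap.sub_apply,
    Submodule.projection_apply_of_mem_left hZ.isCompl hz, add_sub_cancel]
  exact Submodule.projection_apply_mem _ z

theorem mem_iff_of_mapsTo (hZ : IsLagrangianComplement Z) (hZ' : IsLagrangianComplement Z')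
    {ρ : SpFull} (hρ : ∀ z ∈ Z, ρ.1 z ∈ Z') (f : H') : ρ.1 f ∈ Z' ↔ f ∈ Z := by
  refine ⟨fun hf => ?_, hρ f⟩
  obtain ⟨z, h, hz, hh, rfl⟩ := Submodule.codisjoint_iff_exists_add_eq.1 hZ.isCompl.codisjoint f
  have hρh : ρ.1 h ∈ Z' := by
    rw [map_add] at hf
    exact (Submodule.add_mem_iff_right _ (hρ z hz)).1 hf
  have hρh0 : ρ.1 h = 0 := (Submodule.eq_bot_iff _).1 hZ'.inf_eq_bot _ ⟨hρh, (ρ.2.2.2.2 h).2 hh⟩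
  rwa [(LinearEquiv.map_eq_zero_iff _).1 hρh0, add_zero]

/-- The adjoint on `H'₊`, with respect to the form, of an endomorphism of `Z`. -/
def adjoint (hZ : IsLagrangianComplement Z) (N : Z →ₗ[ℂ] Z) : Hplus →ₗ[ℂ] Hplus :=
  hZ.dualEquiv.symm.toLinearMap ∘ₗ N.dualMap ∘ₗ hZ.dualEquiv.toLinearMap

theorem form_adjoint (hZ : IsLagrangianComplement Z) (N : Z →ₗ[ℂ] Z) (h : Hplus) (z : Z) :
    form (hZ.adjoint N h).1 z.1 = form h.1 (N z).1 :=
  hZ.form_dualEquiv_symm _ z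

theorem adjoint_adjoint_eq_zero (hZ : IsLagrangianComplement Z) {N : Z →ₗ[ℂ] Z}
    (hN : ∀ z, N (N z) = 0) (h : Hplus) : hZ.adjoint N (hZ.adjoint N h) = 0 :=
  Subtype.ext <| hZ.eq_zero_of_form_eq_zero (Subtype.prop _) fun z hz => by
    rw [hZ.form_adjoint N _ ⟨z, hz⟩, hZ.form_adjoint, hN, Submodule.coe_zero, map_zero]

/-- The infinitesimal symplectic endomorphism `N ⊕ (-N*)` of `H' = Z ⊕ H'₊`. -/
def extend (hZ : IsLagrangianComplement Z) (N : Z →ₗ[ℂ] Z) : H' →ₗ[ℂ] H' :=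
  LinearMap.ofIsCompl hZ.isCompl (Z.subtype ∘ₗ N) (-(Hplus.subtype ∘ₗ hZ.adjoint N))

theorem extend_left (hZ : IsLagrangianComplement Z) (N : Z →ₗ[ℂ] Z) (z : Z) :
    hZ.extend N z = N z :=
  LinearMap.ofIsCompl_apply_left hZ.isCompl z

theorem extend_right (hZ : IsLagrangianComplement Z) (N : Z →ₗ[ℂ] Z) (h : Hplus) :
    hZ.extend N h = -(hZ.adjoint N h).1 :=
  LinearMap.ofIsCompl_apply_right hZ.isCompl h

theorem exists_add_eq (hZ : IsLagrangianComplement Z) (x : H') :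
    ∃ (z : Z) (h : Hplus), z.1 + h.1 = x := by
  obtain ⟨z, h, hz, hh, rfl⟩ := Submodule.codisjoint_iff_exists_add_eq.1 hZ.isCompl.codisjoint x
  exact ⟨⟨z, hz⟩, ⟨h, hh⟩, rfl⟩

theorem form_extend (hZ : IsLagrangianComplement Z) (N : Z →ₗ[ℂ] Z) (x y : H') :
    form (hZ.extend N x) y = -form x (hZ.extend N y) := by
  obtain ⟨z, h, rfl⟩ := hZ.exists_add_eq x
  obtain ⟨z', h', rfl⟩ := hZ.exists_add_eq y
  have hadj := hZ.form_adjoint N h z'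
  have hadj' := hZ.form_adjoint N h' z
  have hskew := form_skew (N z).1 h'.1
  have hskew' := form_skew z.1 (hZ.adjoint N h').1
  simp only [map_add, map_neg, LinearMap.add_apply, LinearMap.neg_apply, extend_left, extend_right,
    hZ.form_eq_zero (N z).2 z'.2, hZ.form_eq_zero z.2 (N z').2,
    form_eq_zero_of_mem_Hplus h.2 (hZ.adjoint N h').2,
    form_eq_zero_of_mem_Hplus (hZ.adjoint N h).2 h'.2]
  linear_combination hskew - hskew' - hadj + hadj'

theorem isSquareZeroSp_extend (hZ : IsLagrangianComplement Z) {N : Z →ₗ[ℂ] Z}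
    (hN : ∀ z, N (N z) = 0) : IsSquareZeroSp (hZ.extend N) where
  skew := hZ.form_extend N
  sq_eq_zero x := by
    obtain ⟨z, h, rfl⟩ := hZ.exists_add_eq x
    simp only [map_add, map_neg, extend_left, extend_right, hN, hZ.adjoint_adjoint_eq_zero hN,
      Submodule.coe_zero, neg_zero, add_zero]
  map_Hplus h hh := by
    rw [hZ.extend_right N ⟨h, hh⟩]
    exact Submodule.neg_mem _ (Subtype.prop _)

end IsLagrangianComplement

section Intertwines

variable {W : Type*} [AddCommGroup W] [Module ℂ W] {Z Z' Z'' : Submodule ℂ H'}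

/-- `ρ` maps `Z` into `Z'` and takes `p : Z → W` to `p' : Z' → W`. -/
def Intertwines (ρ : SpFull) (p : Z →ₗ[ℂ] W) (p' : Z' →ₗ[ℂ] W) : Prop :=
  ∀ z : Z, ∃ z' : Z', z'.1 = ρ.1 z.1 ∧ p' z' = p z

theorem Intertwines.mul {ρ σ : SpFull} {p : Z →ₗ[ℂ] W} {p' : Z' →ₗ[ℂ] W} {p'' : Z'' →ₗ[ℂ] W}
    (hσ : Intertwines σ p' p'') (hρ : Intertwines ρ p p') : Intertwines (σ * ρ) p p'' := by
  intro z
  obtain ⟨z', h1, h2⟩ := hρ z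
  obtain ⟨z'', h1', h2'⟩ := hσ z'
  exact ⟨z'', h1'.trans (congrArg σ.1 h1), h2'.trans h2⟩

theorem exists_intertwines_of_rightInverse (hZ : IsLagrangianComplement Z) {p p' : Z →ₗ[ℂ] W}
    {s : W →ₗ[ℂ] Z} (hp : p ∘ₗ s = LinearMap.id) (hp' : p' ∘ₗ s = LinearMap.id) :
    ∃ ρ ∈ SpPlus, Intertwines ρ p p' := by
  have hps (w : W) : p (s w) = w := LinearMap.congr_fun hp w
  have hps' (w : W) : p' (s w) = w := LinearMap.congr_fun hp' w
  let N : Z →ₗ[ℂ] Z := s ∘ₗ (p - p')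
  have hN : IsSquareZeroSp (hZ.extend N) :=
    hZ.isSquareZeroSp_extend fun z => by simp [N, hps, hps']
  refine ⟨hN.toSp 1, hN.toSp_mem_SpPlus 1, fun z => ⟨z + N z, ?_, ?_⟩⟩
  · rw [hN.toSp_apply, hZ.extend_left, one_smul, Submodule.coe_add]
  · simp [N, hps']

end Intertwines

theorem exists_injective_of_not_finite {K V W : Type*} [Field K] [AddCommGroup V] [Module K V]
    [AddCommGroup W] [Module K W] [Module.Finite K W] (hV : ¬ Module.Finite K V) :
    ∃ j : W →ₗ[K] V, Function.Injective j := by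
  have hrank : (Module.finrank K W : Cardinal) ≤ Module.rank K V :=
    Cardinal.natCast_lt_aleph0.le.trans (not_lt.1 fun h => hV (Module.rank_lt_aleph0_iff.1 h))
  obtain ⟨f, hf⟩ := Module.le_rank_iff_exists_linearMap.1 hrank
  let e := (Module.finBasis K W).equivFun
  exact ⟨f ∘ₗ e.toLinearMap, hf.comp e.injective⟩

theorem exists_common_rightInverses {K V W : Type*} [Field K] [AddCommGroup V] [Module K V]
    [AddCommGroup W] [Module K W] [Module.Finite K W] (hV : ¬ Module.Finite K V)
    {p p' : V →ₗ[K] W} (hp : Function.Surjective p) (hp' : Function.Surjective p') :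
    ∃ (r : V →ₗ[K] W) (s s' : W →ₗ[K] V), p ∘ₗ s = LinearMap.id ∧ r ∘ₗ s = LinearMap.id ∧
      r ∘ₗ s' = LinearMap.id ∧ p' ∘ₗ s' = LinearMap.id := by
  let k : V →ₗ[K] W × W := p.prod p'
  have hk : ¬ Module.Finite K (LinearMap.ker k) := fun _ =>
    have : Module.Finite K (V ⧸ LinearMap.ker k) :=
      Module.Finite.equiv k.quotKerEquivRange.symm
    hV (Module.Finite.of_submodule_quotient (LinearMap.ker k))
  obtain ⟨i, hi⟩ := exists_injective_of_not_finite (W := W) hk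
  let j : W →ₗ[K] V := (LinearMap.ker k).subtype ∘ₗ i
  have hpj (w : W) : p (j w) = 0 := congrArg Prod.fst (LinearMap.mem_ker.1 (i w).2)
  have hpj' (w : W) : p' (j w) = 0 := congrArg Prod.snd (LinearMap.mem_ker.1 (i w).2)
  obtain ⟨r, hr⟩ := j.exists_leftInverse_of_injective
    (LinearMap.ker_eq_bot.2 ((Submodule.subtype_injective _).comp hi))
  have hrj (w : W) : r (j w) = w := LinearMap.congr_fun hr w
  obtain ⟨s, hs⟩ := p.exists_rightInverse_of_surjective (LinearMap.range_eq_top.2 hp)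
  obtain ⟨s', hs'⟩ := p'.exists_rightInverse_of_surjective (LinearMap.range_eq_top.2 hp')
  have hps (w : W) : p (s w) = w := LinearMap.congr_fun hs w
  have hps' (w : W) : p' (s' w) = w := LinearMap.congr_fun hs' w
  refine ⟨r, s + j ∘ₗ (LinearMap.id - r ∘ₗ s), s' + j ∘ₗ (LinearMap.id - r ∘ₗ s'), ?_, ?_, ?_, ?_⟩
  all_goals ext w; simp [hpj, hpj', hrj, hps, hps']

theorem not_finite_Hplus : ¬ Module.Finite ℂ Hplus := by
  intro _
  have hmem (k : ℕ) : single (k + 1) ∈ Hplus :=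
    ⟨_, mem_tPow.2 fun m hm => by rw [coeff_singleH, if_neg (by omega)], rfl⟩
  let coeffs : Hplus →ₗ[ℂ] ℕ → ℂ := LinearMap.pi fun k => coeff (k + 1) ∘ₗ sec ∘ₗ Hplus.subtype
  have hli : LinearIndependent ℂ fun k : ℕ => (⟨_, hmem k⟩ : Hplus) := by
    refine LinearIndependent.of_comp coeffs ?_
    convert Pi.linearIndependent_single_one ℕ ℂ with k
    ext l
    change coeff (l + 1) (sec (single (k + 1))) = _
    rw [coeff_sec_single, Pi.single_apply]
    exact if_congr (by omega) rfl rfl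
  exact not_finite_iff_infinite.2 inferInstance hli.finite

theorem IsLagrangianComplement.not_finite {Z : Submodule ℂ H'} (hZ : IsLagrangianComplement Z) :
    ¬ Module.Finite ℂ Z := fun _ =>
  not_finite_Hplus (Module.Finite.equiv hZ.dualEquiv.symm)

theorem exists_intertwines {W : Type*} [AddCommGroup W] [Module ℂ W] [Module.Finite ℂ W]
    {Z Z' : Submodule ℂ H'} (hZ : IsLagrangianComplement Z) (hZ' : IsLagrangianComplement Z')
    {p : Z →ₗ[ℂ] W} {p' : Z' →ₗ[ℂ] W} (hp : Function.Surjective p)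
    (hp' : Function.Surjective p') : ∃ ρ ∈ SpPlus, Intertwines ρ p p' := by
  obtain ⟨σ, hσ, hσZ⟩ := hZ.exists_mapsTo hZ'
  let τ : Z →ₗ[ℂ] Z' := σ.1.toLinearMap.restrict hσZ
  have hτ : Function.Surjective τ := fun z' => by
    obtain ⟨z, hz⟩ := σ.1.surjective z'.1
    exact ⟨⟨z, (hZ.mem_iff_of_mapsTo hZ' hσZ z).1 (hz ▸ z'.2)⟩, Subtype.ext hz⟩
  obtain ⟨r, s, s', hps, hrs, hrs', hps'⟩ :=
    exists_common_rightInverses hZ.not_finite hp (p' := p' ∘ₗ τ) (hp'.comp hτ)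
  obtain ⟨ρ, hρ, hpr⟩ := exists_intertwines_of_rightInverse hZ hps hrs
  obtain ⟨ρ', hρ', hrp'⟩ := exists_intertwines_of_rightInverse hZ hrs' hps'
  have hσp : Intertwines σ (p' ∘ₗ τ) p' := fun z => ⟨τ z, rfl, rfl⟩
  exact ⟨_, mul_mem_SpPlus hσ (mul_mem_SpPlus hρ' hρ), hσp.mul (hrp'.mul hpr)⟩

/-! ### Points of `Sp(X, Θ)` and their moves -/

theorem Intertwines.apply_eq {W : Type*} [AddCommGroup W] [Module ℂ W] {Z Z' : Submodule ℂ H'}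
    {ρ : SpFull} {p : Z →ₗ[ℂ] W} {p' : Z' →ₗ[ℂ] W} (h : Intertwines ρ p p') {z : Z} {z' : Z'}
    (hz : z'.1 = ρ.1 z.1) : p' z' = p z := by
  obtain ⟨y, hy, hpy⟩ := h z
  rw [← hpy, Subtype.ext (hz.trans hy.symm)]

theorem Intertwines.mapsTo {W : Type*} [AddCommGroup W] [Module ℂ W] {Z Z' : Submodule ℂ H'}
    {ρ : SpFull} {p : Z →ₗ[ℂ] W} {p' : Z' →ₗ[ℂ] W} (h : Intertwines ρ p p') :
    ∀ z ∈ Z, ρ.1 z ∈ Z' := fun z hz => by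
  obtain ⟨z', hz', -⟩ := h ⟨z, hz⟩
  exact hz' ▸ z'.2

namespace Sp

variable {W : Type*} [NormedAddCommGroup W] [NormedSpace ℂ W] {P : PPAV W}

theorem isLagrangianComplement (x : Sp P) : IsLagrangianComplement x.a.Z :=
  ⟨x.a.lagrangian, x.a.disjoint_plus⟩

/-- The composition `Z → Z / F ≅ W`. -/
def proj (x : Sp P) : x.a.Z →ₗ[ℂ] W := x.iso.toLinearMap ∘ₗ (x.a.F.submoduleOf x.a.Z).mkQ

theorem proj_surjective (x : Sp P) : Function.Surjective x.proj :=
  x.iso.surjective.comp (Submodule.mkQ_surjective _)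

theorem proj_eq_zero_iff (x : Sp P) (z : x.a.Z) : x.proj z = 0 ↔ z.1 ∈ x.a.F :=
  x.iso.map_eq_zero_iff.trans (Submodule.Quotient.mk_eq_zero _)

theorem mem_F_iff (x : Sp P) (f : H') :
    f ∈ x.a.F ↔ ∃ hf : f ∈ x.a.Z, x.proj ⟨f, hf⟩ = 0 := by
  simp only [proj_eq_zero_iff, exists_prop]
  exact ⟨fun hf => ⟨x.a.F_le hf, hf⟩, And.right⟩

theorem le_perp (x : Sp P) : x.a.Z ≤ perp x.a.F :=
  AbelianCoinvariants.le_perp x.a.F_le x.a.lagrangian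

theorem isConj_of_add_mem_L (x : Sp P) {u : x.a.Tangent} {p : Red x.a.F} (hp : p ∈ redPlus x.a.F)
    (hL : x.a.incl u + p ∈ x.a.L) : IsConj x.a.L (x.a.incl u) p := by
  obtain ⟨p', hp', y, hy, y', hy', hu, rfl⟩ := x.a.conj_plus u
  change x.a.incl u = y + Complex.I • y' at hu
  -- `p - p'` is real, being the difference of the real vectors `u + p` and `u + p' = 2 y`.
  have hreal : p - (y - Complex.I • y') ∈ Submodule.span ℝ (x.a.L : Set (Red x.a.F)) := by
    have h := Submodule.sub_mem _ (Submodule.subset_span hL) (Submodule.add_mem _ hy hy)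
    convert h using 1
    rw [hu]
    abel
  rw [sub_eq_zero.1 (x.a.disjoint_real _ hreal (Submodule.sub_mem _ hp hp'))]
  exact ⟨y, hy, y', hy', hu, rfl⟩

theorem form_eq_of_add_mem_L (x : Sp P) {z : x.a.Z} {h : perp x.a.F} (hh : h.1 ∈ Hplus)
    (hL : x.a.incl ((x.a.F.submoduleOf _).mkQ z) + (x.a.F.submoduleOf _).mkQ h ∈ x.a.L)
    (v : x.a.Z) : form h.1 v.1 = Real.pi * P.B (x.proj z) (x.proj v) := by
  have hB : P.B (x.proj z) (x.proj v) = (1 / Real.pi : ℂ) * form h.1 v.1 :=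
    x.iso_form _ ((x.a.F.submoduleOf _).mkQ v) _ (x.isConj_of_add_mem_L ⟨h, hh, rfl⟩ hL)
  have hpi : (Real.pi : ℂ) ≠ 0 := by exact_mod_cast Real.pi_ne_zero
  rw [hB]
  field_simp

theorem mk_mem_L_iff (x : Sp P) (f : perp x.a.F) (z : x.a.Z) {h : H'} (hh : h ∈ Hplus)
    (hf : f.1 = z.1 + h) :
    (x.a.F.submoduleOf _).mkQ f ∈ x.a.L ↔
      x.proj z ∈ P.Λ ∧ ∀ v : x.a.Z, form h v.1 = Real.pi * P.B (x.proj z) (x.proj v) := by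
  have hperp : h ∈ perp x.a.F := by
    simpa [hf] using Submodule.sub_mem _ f.2 (x.le_perp z.2)
  have hmk : (x.a.F.submoduleOf _).mkQ f =
      x.a.incl ((x.a.F.submoduleOf _).mkQ z) + (x.a.F.submoduleOf _).mkQ ⟨h, hperp⟩ :=
    congrArg (x.a.F.submoduleOf _).mkQ
      (Subtype.ext hf : f = ⟨z.1, x.le_perp z.2⟩ + ⟨h, hperp⟩)
  rw [hmk]
  constructor
  · exact fun hL => ⟨(x.iso_lattice _).2 ⟨_, ⟨⟨h, hperp⟩, hh, rfl⟩, hL⟩,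
      x.form_eq_of_add_mem_L hh hL⟩
  · rintro ⟨hΛ, hB⟩
    obtain ⟨_, ⟨k, hk, rfl⟩, hL⟩ := (x.iso_lattice ((x.a.F.submoduleOf _).mkQ z)).1 hΛ
    have hsub : h - k.1 = 0 := x.isLagrangianComplement.eq_zero_of_form_eq_zero
      (Submodule.sub_mem _ hh hk) fun v hv => by
        rw [map_sub, LinearMap.sub_apply, hB ⟨v, hv⟩, x.form_eq_of_add_mem_L hk hL ⟨v, hv⟩,
          sub_self]
    rwa [Subtype.ext (sub_eq_zero.1 hsub : (⟨h, hperp⟩ : perp x.a.F).1 = k.1)]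

section Moves

variable {x x' : Sp P} {ρ : SpFull} (h : Intertwines ρ x.proj x'.proj)

include h

theorem map_Z_iff_of_intertwines (f : H') : ρ.1 f ∈ x'.a.Z ↔ f ∈ x.a.Z :=
  x.isLagrangianComplement.mem_iff_of_mapsTo x'.isLagrangianComplement h.mapsTo f

theorem map_F_iff_of_intertwines (f : H') : ρ.1 f ∈ x'.a.F ↔ f ∈ x.a.F := by
  rw [mem_F_iff, mem_F_iff]
  exact ⟨fun ⟨hf, h0⟩ => ⟨(map_Z_iff_of_intertwines h f).1 hf, (h.apply_eq rfl).symm.trans h0⟩,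
    fun ⟨hf, h0⟩ => ⟨(map_Z_iff_of_intertwines h f).2 hf, (h.apply_eq rfl).trans h0⟩⟩

theorem map_L_iff_of_intertwines (f : perp x.a.F) (f' : perp x'.a.F) (hf : f'.1 = ρ.1 f.1) :
    (x'.a.F.submoduleOf _).mkQ f' ∈ x'.a.L ↔ (x.a.F.submoduleOf _).mkQ f ∈ x.a.L := by
  obtain ⟨z, k, hzk⟩ := x.isLagrangianComplement.exists_add_eq f.1
  obtain ⟨z', hz', hpz'⟩ := h z
  have hf' : f'.1 = z'.1 + ρ.1 k := by rw [hf, ← hzk, map_add, hz']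
  rw [x.mk_mem_L_iff f z k.2 hzk.symm, x'.mk_mem_L_iff f' z' ((ρ.2.2.2.2 k).2 k.2) hf', hpz']
  refine and_congr_right fun _ => ⟨fun hB v => ?_, fun hB v' => ?_⟩
  · obtain ⟨v', hv', hpv'⟩ := h v
    rw [← hpv', ← hB, hv', ρ.2.2.2.1]
  · obtain ⟨v, hv⟩ := ρ.1.surjective v'.1
    have hvZ : v ∈ x.a.Z := (map_Z_iff_of_intertwines h v).1 (hv ▸ v'.2)
    rw [h.apply_eq (z := ⟨v, hvZ⟩) hv.symm, ← hB, ← hv, ρ.2.2.2.1]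

theorem moves_of_intertwines : Moves ρ x x' where
  map_Z := map_Z_iff_of_intertwines h
  map_F := map_F_iff_of_intertwines h
  map_L := map_L_iff_of_intertwines h
  map_iso _ _ := h.apply_eq

end Moves

theorem exists_moves [FiniteDimensional ℂ W] (x x' : Sp P) : ∃ ρ ∈ SpPlus, Moves ρ x x' := by
  obtain ⟨ρ, hρ, h⟩ := exists_intertwines x.isLagrangianComplement x'.isLagrangianComplement
    x.proj_surjective x'.proj_surjective
  exact ⟨ρ, hρ, moves_of_intertwines h⟩

end Sp

/-! ### Existence of extended PPAVs -/

theorem redForm_skew (F : Submodule ℂ H') (x y : Red F) : redForm F x y = -redForm F y x := by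
  obtain ⟨f, rfl⟩ := Submodule.mkQ_surjective _ x
  obtain ⟨g, rfl⟩ := Submodule.mkQ_surjective _ y
  exact form_skew f.1 g.1

theorem redForm_eq_zero_of_mem_redPlus {F : Submodule ℂ H'} {x y : Red F} (hx : x ∈ redPlus F)
    (hy : y ∈ redPlus F) : redForm F x y = 0 := by
  obtain ⟨f, hf, rfl⟩ := hx
  obtain ⟨g, hg, rfl⟩ := hy
  exact form_eq_zero_of_mem_Hplus hf hg

namespace PPAV

variable {W : Type*} [NormedAddCommGroup W] [NormedSpace ℂ W] (P : PPAV W)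

theorem eq_zero_of_B_self {w : W} (h : P.B w w = 0) : w = 0 := by
  by_contra hw
  exact (P.positive w hw).ne' (by rw [h, Complex.zero_re])

theorem B_sub_B_swap (u v : W) : P.B u v - P.B v u = 2 * Complex.I * (P.B u v).im := by
  rw [← P.hermitian u v, Complex.sub_conj]
  push_cast
  ring

theorem isZLattice [DiscreteTopology P.Λ] : IsZLattice ℝ P.Λ := ⟨P.span_top⟩

variable [FiniteDimensional ℂ W]

theorem finite_lattice : Module.Finite ℤ P.Λ := by
  have := P.discrete
  have := P.isZLattice
  have := FiniteDimensional.complexToReal W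
  exact ZLattice.module_finite ℝ P.Λ

theorem finrank_lattice : Module.finrank ℤ P.Λ = 2 * Module.finrank ℂ W := by
  have := P.discrete
  have := P.isZLattice
  have := FiniteDimensional.complexToReal W
  rw [ZLattice.rank ℝ P.Λ, finrank_real_of_complex]

end PPAV

/-- A Lagrangian complement `Z` of `H'₊` with a surjection onto `W`, the data from which an extended
PPAV over a PPAV with tangent space `W` is constructed. -/
structure LagrangianQuotient (W : Type*) [AddCommGroup W] [Module ℂ W] where
  Z : Submodule ℂ H'
  compl : IsLagrangianComplement Z
  proj : Z →ₗ[ℂ] W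
  surjective : Function.Surjective proj

namespace LagrangianQuotient

section

variable {W : Type*} [AddCommGroup W] [Module ℂ W] (Q : LagrangianQuotient W)

/-- The kernel of `Z → W` as a subspace of `H'`. -/
def F : Submodule ℂ H' := (LinearMap.ker Q.proj).map Q.Z.subtype

theorem F_le : Q.F ≤ Q.Z := Submodule.map_subtype_le _ _

theorem submoduleOf_F : Q.F.submoduleOf Q.Z = LinearMap.ker Q.proj :=
  Submodule.comap_map_eq_of_injective Q.Z.injective_subtype _

/-- The isomorphism `Z / F ≅ W`. -/
def tangentEquiv : (Q.Z ⧸ Q.F.submoduleOf Q.Z) ≃ₗ[ℂ] W :=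
  (Submodule.quotEquivOfEq _ _ Q.submoduleOf_F).trans
    (Q.proj.quotKerEquivOfSurjective Q.surjective)

theorem tangentEquiv_mkQ (z : Q.Z) : Q.tangentEquiv ((Q.F.submoduleOf Q.Z).mkQ z) = Q.proj z := rfl

/-- The inclusion of `W ≅ Z / F` in `F^⊥ / F`. -/
def lin : W →ₗ[ℂ] Red Q.F :=
  redIncl (le_perp Q.F_le Q.compl.perp_eq) ∘ₗ Q.tangentEquiv.symm.toLinearMap

theorem lin_tangentEquiv (u : Q.Z ⧸ Q.F.submoduleOf Q.Z) :
    Q.lin (Q.tangentEquiv u) = redIncl (le_perp Q.F_le Q.compl.perp_eq) u := by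
  rw [lin, LinearMap.comp_apply, LinearEquiv.coe_coe, LinearEquiv.symm_apply_apply]

theorem lin_proj (z : Q.Z) : Q.lin (Q.proj z) =
    (Q.F.submoduleOf _).mkQ ⟨z.1, le_perp Q.F_le Q.compl.perp_eq z.2⟩ := by
  rw [← tangentEquiv_mkQ, lin_tangentEquiv]
  rfl

theorem redForm_lin_lin (u v : W) : redForm Q.F (Q.lin u) (Q.lin v) = 0 := by
  obtain ⟨y, rfl⟩ := Q.surjective u
  obtain ⟨z, rfl⟩ := Q.surjective v
  rw [lin_proj, lin_proj]
  exact Q.compl.form_eq_zero y.2 z.2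

theorem eq_zero_of_lin_mem_redPlus {w : W} (h : Q.lin w ∈ redPlus Q.F) : w = 0 := by
  obtain ⟨z, rfl⟩ := Q.surjective w
  obtain ⟨k, hk, hkz⟩ := h
  rw [lin_proj] at hkz
  have hsub : k.1 - z.1 ∈ Q.F := (Submodule.Quotient.eq (Q.F.submoduleOf _)).1 hkz
  have hkZ : k.1 ∈ Q.Z := by simpa using Submodule.add_mem _ (Q.F_le hsub) z.2
  have hk0 : k.1 = 0 := (Submodule.mem_bot ℂ).1 (Q.compl.inf_eq_bot ▸ ⟨hkZ, hk⟩)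
  rw [hk0, zero_sub, Submodule.neg_mem_iff] at hsub
  have hz : z ∈ Q.F.submoduleOf Q.Z := hsub
  rwa [submoduleOf_F] at hz

end

variable {W : Type*} [NormedAddCommGroup W] [NormedSpace ℂ W] (Q : LagrangianQuotient W)
  (P : PPAV W)

/-- The antilinear map from `W` to `H'₊` defined by `⟨c(w), z⟩ = π B(w, p(z))`. -/
def conjPlus : W →ₗ⋆[ℂ] Hplus where
  toFun w := Q.compl.dualEquiv.symm ((Real.pi : ℂ) • (P.B w ∘ₗ Q.proj))
  map_add' u v := by rw [← map_add]; congr 1; ext z; simp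
  map_smul' c u := by rw [← map_smul]; congr 1; ext z; simp; ring

theorem form_conjPlus (w : W) (z : Q.Z) :
    form (Q.conjPlus P w).1 z.1 = Real.pi * P.B w (Q.proj z) :=
  Q.compl.form_dualEquiv_symm _ z

theorem conjPlus_mem_perp (w : W) : (Q.conjPlus P w).1 ∈ perp Q.F := by
  rintro _ ⟨z, hz, rfl⟩
  change form z.1 _ = 0
  rw [form_skew, form_conjPlus, LinearMap.mem_ker.1 hz, map_zero, mul_zero, neg_zero]

/-- The conjugate in `F^⊥₊` of the image of `w` in `Z / F`. -/
def conj : W →ₗ⋆[ℂ] Red Q.F :=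
  (Q.F.submoduleOf _).mkQ.comp
    ((Hplus.subtype.comp (Q.conjPlus P)).codRestrict _ (Q.conjPlus_mem_perp P))

theorem conj_mem_redPlus (w : W) : Q.conj P w ∈ redPlus Q.F :=
  ⟨⟨_, Q.conjPlus_mem_perp P w⟩, (Q.conjPlus P w).2, rfl⟩

theorem redForm_conj_lin (u v : W) :
    redForm Q.F (Q.conj P u) (Q.lin v) = Real.pi * P.B u v := by
  obtain ⟨z, rfl⟩ := Q.surjective v
  rw [lin_proj]
  exact Q.form_conjPlus P u z

theorem B_eq_redForm_conj_lin (u v : W) :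
    P.B u v = (1 / Real.pi : ℂ) * redForm Q.F (Q.conj P u) (Q.lin v) := by
  have hpi : (Real.pi : ℂ) ≠ 0 := by exact_mod_cast Real.pi_ne_zero
  rw [redForm_conj_lin, ← mul_assoc, one_div_mul_cancel hpi, one_mul]

theorem eq_zero_of_conj_eq_zero {w : W} (h : Q.conj P w = 0) : w = 0 :=
  P.eq_zero_of_B_self <| by
    rw [Q.B_eq_redForm_conj_lin, h, map_zero, LinearMap.zero_apply, mul_zero]

/-- The embedding `w ↦ w + w̄` of `W` as the real part of `F^⊥ / F`. -/
def real : W →ₗ[ℝ] Red Q.F where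
  toFun w := Q.lin w + Q.conj P w
  map_add' u v := by simp only [map_add]; abel
  map_smul' r u := by
    have h : r • u = (r : ℂ) • u := rfl
    rw [h, map_smul, LinearMap.map_smulₛₗ, Complex.conj_ofReal, ← smul_add]
    rfl

theorem real_apply (w : W) : Q.real P w = Q.lin w + Q.conj P w := rfl

theorem real_add_I_smul_real (u v : W) : Q.real P u + Complex.I • Q.real P v =
    Q.lin (u + Complex.I • v) + Q.conj P (u - Complex.I • v) := by
  simp only [real_apply, map_add, map_sub, map_smul, LinearMap.map_smulₛₗ, Complex.conj_I]
  module

theorem real_sub_I_smul_real (u v : W) : Q.real P u - Complex.I • Q.real P v =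
    Q.lin (u - Complex.I • v) + Q.conj P (u + Complex.I • v) := by
  simpa [sub_eq_add_neg] using Q.real_add_I_smul_real P u (-v)

theorem eq_of_lin_eq_add {u v : W} {k : Red Q.F} (hk : k ∈ redPlus Q.F)
    (h : Q.lin u = Q.lin v + k) : u = v := by
  refine sub_eq_zero.1 (Q.eq_zero_of_lin_mem_redPlus ?_)
  rwa [map_sub, h, add_sub_cancel_left]

theorem real_injective : Function.Injective (Q.real P) := by
  refine (injective_iff_map_eq_zero _).2 fun w hw => Q.eq_zero_of_lin_mem_redPlus ?_
  rw [eq_neg_of_add_eq_zero_left hw]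
  exact Submodule.neg_mem _ (Q.conj_mem_redPlus P w)

theorem redForm_real_real (u v : W) :
    redForm Q.F (Q.real P u) (Q.real P v) = 2 * Real.pi * Complex.I * (P.B u v).im := by
  have hconj := redForm_eq_zero_of_mem_redPlus (Q.conj_mem_redPlus P u) (Q.conj_mem_redPlus P v)
  simp only [real_apply, map_add, LinearMap.add_apply]
  rw [redForm_lin_lin, redForm_skew Q.F (Q.lin u), redForm_conj_lin, redForm_conj_lin, hconj]
  linear_combination (Real.pi : ℂ) * P.B_sub_B_swap u v

/-- The lattice in `F^⊥ / F`, the image of `Λ` under `w ↦ w + w̄`. -/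
def lattice : Submodule ℤ (Red Q.F) := P.Λ.map (Q.real P).toAddMonoidHom.toIntLinearMap

/-- The isomorphism from `Λ` to its image in `F^⊥ / F`. -/
def latticeEquiv : P.Λ ≃ₗ[ℤ] Q.lattice P :=
  Submodule.equivMapOfInjective (Q.real P).toAddMonoidHom.toIntLinearMap (Q.real_injective P) P.Λ

theorem mem_span_lattice_iff (x : Red Q.F) :
    x ∈ Submodule.span ℝ (Q.lattice P : Set (Red Q.F)) ↔ ∃ w, Q.real P w = x := by
  have himage : (Q.lattice P : Set (Red Q.F)) = Q.real P '' (P.Λ : Set W) := rfl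
  rw [himage, Submodule.span_image, P.span_top, Submodule.map_top]
  exact LinearMap.mem_range

theorem isConj_lin_iff {u : W} {u' : Red Q.F} :
    IsConj (Q.lattice P) (Q.lin u) u' ↔ u' = Q.conj P u := by
  constructor
  · rintro ⟨x, hx, y, hy, hu, rfl⟩
    obtain ⟨a, rfl⟩ := (Q.mem_span_lattice_iff P x).1 hx
    obtain ⟨b, rfl⟩ := (Q.mem_span_lattice_iff P y).1 hy
    rw [real_add_I_smul_real] at hu
    obtain rfl : u = a + Complex.I • b := Q.eq_of_lin_eq_add (Q.conj_mem_redPlus P _) hu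
    have hab : a - Complex.I • b = 0 := Q.eq_zero_of_conj_eq_zero P (left_eq_add.1 hu)
    rw [real_sub_I_smul_real, hab, map_zero, zero_add]
  · rintro rfl
    let a : W := (2⁻¹ : ℂ) • u
    let b : W := (-(2⁻¹ * Complex.I) : ℂ) • u
    have hIb : Complex.I • b = a := by
      rw [smul_smul]
      congr 1
      linear_combination -(2⁻¹ : ℂ) * Complex.I_mul_I
    have haa : a + a = u := by rw [← add_smul]; norm_num
    refine ⟨_, (Q.mem_span_lattice_iff P _).2 ⟨a, rfl⟩, _, (Q.mem_span_lattice_iff P _).2 ⟨b, rfl⟩,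
      ?_, ?_⟩
    · rw [real_add_I_smul_real, hIb, haa, sub_self, map_zero, add_zero]
    · rw [real_sub_I_smul_real, hIb, haa, sub_self, map_zero, zero_add]

theorem B_tangentEquiv_eq {u v : Q.Z ⧸ Q.F.submoduleOf Q.Z} {u' : Red Q.F}
    (h : IsConj (Q.lattice P) (redIncl (le_perp Q.F_le Q.compl.perp_eq) u) u') :
    P.B (Q.tangentEquiv u) (Q.tangentEquiv v) =
      (1 / Real.pi : ℂ) * redForm Q.F u' (redIncl (le_perp Q.F_le Q.compl.perp_eq) v) := by
  rw [← lin_tangentEquiv] at h ⊢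
  rw [(Q.isConj_lin_iff P).1 h, ← B_eq_redForm_conj_lin]

theorem tangentEquiv_mem_iff (u : Q.Z ⧸ Q.F.submoduleOf Q.Z) :
    Q.tangentEquiv u ∈ P.Λ ↔
      ∃ k ∈ redPlus Q.F, redIncl (le_perp Q.F_le Q.compl.perp_eq) u + k ∈ Q.lattice P := by
  rw [← lin_tangentEquiv]
  constructor
  · exact fun hu => ⟨_, Q.conj_mem_redPlus P _, _, hu, rfl⟩
  · rintro ⟨k, hk, w, hw, h⟩
    have hlin : Q.lin (Q.tangentEquiv u) = Q.lin w + (Q.conj P w - k) := by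
      rw [← add_sub_assoc]
      exact eq_sub_of_add_eq h.symm
    rwa [Q.eq_of_lin_eq_add (Submodule.sub_mem _ (Q.conj_mem_redPlus P w) hk) hlin]

theorem existsUnique_redForm_eq (φ : Q.lattice P →ₗ[ℤ] ℤ) :
    ∃! l : Q.lattice P, ∀ m : Q.lattice P,
      redForm Q.F l.1 m.1 = 2 * Real.pi * Complex.I * (φ m : ℤ) := by
  let e := Q.latticeEquiv P
  have hc : (2 * Real.pi * Complex.I : ℂ) ≠ 0 := by simp [Real.pi_ne_zero]
  have hiff (u : P.Λ) : (∀ m, redForm Q.F (e u).1 m.1 = 2 * Real.pi * Complex.I * (φ m : ℤ)) ↔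
      ∀ v : P.Λ, (P.B u.1 v.1).im = ((φ ∘ₗ e.toLinearMap) v : ℤ) := by
    refine e.surjective.forall.trans (forall_congr' fun v => ?_)
    change redForm Q.F (Q.real P u.1) (Q.real P v.1) = _ ↔ _
    rw [redForm_real_real, mul_right_inj' hc]
    exact ⟨fun h => by exact_mod_cast h, fun h => by rw [h]; simp⟩
  refine e.bijective.existsUnique_iff.2 ?_
  simpa only [hiff] using P.unimodular (φ ∘ₗ e.toLinearMap)

variable [FiniteDimensional ℂ W]

/-- The extended PPAV `(Z, F, L)` determined by `Z → W`. -/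
def toExtPPAV : ExtPPAV (Module.finrank ℂ W) where
  Z := Q.Z
  F := Q.F
  F_le := Q.F_le
  lagrangian := Q.compl.perp_eq
  finite := Module.Finite.equiv Q.tangentEquiv.symm
  codim := Q.tangentEquiv.finrank_eq
  L := Q.lattice P
  L_fg := (Module.Finite.iff_fg.1 P.finite_lattice).map _
  L_rank := (Q.latticeEquiv P).finrank_eq.symm.trans P.finrank_lattice
  disjoint_plus := Q.compl.inf_eq_bot
  disjoint_real x hx hx' := by
    obtain ⟨w, rfl⟩ := (Q.mem_span_lattice_iff P x).1 hx
    have hlin := (Submodule.add_mem_iff_left _ (Q.conj_mem_redPlus P w)).1 hx'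
    rw [Q.eq_zero_of_lin_mem_redPlus hlin, map_zero]
  conj_plus u := by
    rw [← lin_tangentEquiv]
    exact ⟨_, Q.conj_mem_redPlus P _, (Q.isConj_lin_iff P).2 rfl⟩
  integral := by
    rintro _ ⟨u, hu, rfl⟩ _ ⟨v, hv, rfl⟩
    obtain ⟨n, hn⟩ := P.integral u hu v hv
    refine ⟨n, (Q.redForm_real_real P u v).trans ?_⟩
    rw [hn, Complex.ofReal_intCast]
  unimodular := Q.existsUnique_redForm_eq P
  positive u hu u' h := by
    rw [← Q.B_tangentEquiv_eq P h]
    exact P.positive _ (Q.tangentEquiv.map_ne_zero_iff.2 hu)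

/-- The point of `Sp(X, Θ)` determined by `Z → W`. -/
def toSp : Sp P where
  a := Q.toExtPPAV P
  iso := Q.tangentEquiv
  iso_lattice := Q.tangentEquiv_mem_iff P
  iso_form _ _ _ h := Q.B_tangentEquiv_eq P h

end LagrangianQuotient

theorem nonempty_Sp {W : Type*} [NormedAddCommGroup W] [NormedSpace ℂ W] [FiniteDimensional ℂ W]
    (P : PPAV W) : Nonempty (Sp P) := by
  obtain ⟨j, hj⟩ :=
    exists_injective_of_not_finite (W := W) isLagrangianComplement_Hminus.not_finite
  obtain ⟨p, hp⟩ := j.exists_leftInverse_of_injective (LinearMap.ker_eq_bot.2 hj)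
  let Q : LagrangianQuotient W :=
    ⟨Hminus, isLagrangianComplement_Hminus, p, fun w => ⟨j w, LinearMap.congr_fun hp w⟩⟩
  exact ⟨Q.toSp P⟩

/-! ### The Fock space of level zero and its coinvariants -/

open scoped IsMulCommutative in
theorem exists_symmetricAlgebra_lift {R M A : Type*} [CommRing R] [AddCommGroup M] [Module R M]
    [Ring A] [Algebra R A] (f : M →ₗ[R] A) (hf : ∀ x y, f x * f y = f y * f x) :
    ∃ Φ : SymmetricAlgebra R M →ₐ[R] A, ∀ x, Φ (SymmetricAlgebra.ι R M x) = f x := by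
  let S := Algebra.adjoin R (Set.range f)
  have : IsMulCommutative S := Algebra.isMulCommutative_adjoin R <| by
    rintro _ ⟨x, rfl⟩ _ ⟨y, rfl⟩
    exact hf x y
  let g : M →ₗ[R] S := f.codRestrict (Subalgebra.toSubmodule S) fun x =>
    Algebra.subset_adjoin ⟨x, rfl⟩
  refine ⟨S.val.comp (SymmetricAlgebra.lift g), fun x => ?_⟩
  rw [AlgHom.comp_apply, SymmetricAlgebra.lift_ι_apply]
  rfl

section Fock

attribute [local instance] LieRing.ofAssociativeRing

variable {Γ : Type*} [AddCommGroup Γ] (q : EvenLattice Γ)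

theorem env_induction {C : Env q → Prop} (algebraMap : ∀ c, C (algebraMap ℂ (Env q) c))
    (ι : ∀ x, C (UniversalEnvelopingAlgebra.ι ℂ x)) (mul : ∀ u v, C u → C v → C (u * v))
    (add : ∀ u v, C u → C v → C (u + v)) (u : Env q) : C u := by
  obtain ⟨a, rfl⟩ : ∃ a, UniversalEnvelopingAlgebra.mkAlgHom ℂ (Heis q) a = u :=
    Quotient.mk_surjective u
  induction a using TensorAlgebra.induction with
  | algebraMap c => rw [AlgHom.commutes]; exact algebraMap c
  | ι x => exact ι x
  | mul x y hx hy => rw [map_mul]; exact mul _ _ hx hy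
  | add x y hx hy => rw [map_add]; exact add _ _ hx hy

theorem ι_mul_ι_sub (x y : Heis q) :
    UniversalEnvelopingAlgebra.ι ℂ x * UniversalEnvelopingAlgebra.ι ℂ y -
      UniversalEnvelopingAlgebra.ι ℂ y * UniversalEnvelopingAlgebra.ι ℂ x =
    loopForm q x.1 y.1 • UniversalEnvelopingAlgebra.ι ℂ (Heis.central q) := by
  rw [← LieRing.of_associative_ring_bracket, ← LieHom.map_lie, ← map_smul]
  congr 1
  exact Prod.ext (smul_zero _).symm (mul_one _).symm

theorem central_commute (u : Env q) :
    Commute (UniversalEnvelopingAlgebra.ι ℂ (Heis.central q)) u := by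
  induction u using env_induction with
  | algebraMap c => exact (Algebra.commutes c _).symm
  | ι x =>
    have hform : loopForm q (Heis.central q).1 x.1 = 0 := (loopForm q).map_zero₂ x.1
    rw [commute_iff_eq, ← sub_eq_zero, ι_mul_ι_sub, hform, zero_smul]
  | mul u v hu hv => exact hu.mul_right hv
  | add u v hu hv => exact hu.add_right hv

theorem loop_add_central (x : Heis q) : Heis.loop q x.1 + x.2 • Heis.central q = x := by
  refine Prod.ext ?_ ?_
  · change x.1 + x.2 • (0 : Cartan Γ ⊗[ℂ] H) = x.1
    rw [smul_zero, add_zero]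
  · change 0 + x.2 * 1 = x.2
    rw [mul_one, zero_add]

section LevelZero

variable {N : Type*} [AddCommGroup N] [Module (Env q) N] [Module ℂ N] [IsScalarTower ℂ (Env q) N]

theorem smul_smul_comm_of_central
    (hcentral : ∀ n : N, UniversalEnvelopingAlgebra.ι ℂ (Heis.central q) • n = 0)
    (u v : Env q) (n : N) : u • v • n = v • u • n := by
  induction u using env_induction generalizing n with
  | algebraMap c => rw [algebraMap_smul, algebraMap_smul, smul_comm]
  | mul u u' hu hu' => rw [mul_smul, mul_smul, hu', hu]
  | add u u' hu hu' => rw [add_smul, add_smul, smul_add, hu, hu']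
  | ι x =>
    induction v using env_induction generalizing n with
    | algebraMap c => rw [algebraMap_smul, algebraMap_smul, smul_comm]
    | mul v v' hv hv' => rw [mul_smul, mul_smul, hv, hv']
    | add v v' hv hv' => rw [add_smul, add_smul, smul_add, hv, hv']
    | ι y =>
      rw [← mul_smul, ← mul_smul, ← sub_eq_zero, ← sub_smul, ι_mul_ι_sub, smul_assoc, hcentral,
        smul_zero]

theorem ι_smul_of_central
    (hcentral : ∀ n : N, UniversalEnvelopingAlgebra.ι ℂ (Heis.central q) • n = 0)
    (x : Heis q) (n : N) : UniversalEnvelopingAlgebra.ι ℂ x • n =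
      UniversalEnvelopingAlgebra.ι ℂ (Heis.loop q x.1) • n := by
  conv_lhs => rw [← loop_add_central q x, map_add, map_smul, add_smul, smul_assoc, hcentral,
    smul_zero, add_zero]

end LevelZero

variable {M : Type*} [AddCommGroup M] [Module ℂ M]

/-- The homomorphism from the enveloping algebra to `Sym(𝔥_Γ ⊗ M)` induced by a linear map
`H' → M`. -/
def symbol (π : H' →ₗ[ℂ] M) : Env q →ₐ[ℂ] SymmetricAlgebra ℂ (Cartan Γ ⊗[ℂ] M) :=
  UniversalEnvelopingAlgebra.lift ℂ
    { toLinearMap := SymmetricAlgebra.ι ℂ _ ∘ₗ (π ∘ₗ constLine.mkQ).lTensor (Cartan Γ) ∘ₗ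
        (LinearMap.fst ℂ (Cartan Γ ⊗[ℂ] H) ℂ : Heis q →ₗ[ℂ] Cartan Γ ⊗[ℂ] H)
      map_lie' := by
        intro x y
        rw [LieRing.of_associative_ring_bracket, mul_comm, sub_self]
        exact map_zero (SymmetricAlgebra.ι ℂ _ ∘ₗ (π ∘ₗ constLine.mkQ).lTensor (Cartan Γ)) }

theorem symbol_ι (π : H' →ₗ[ℂ] M) (x : Heis q) :
    symbol q π (UniversalEnvelopingAlgebra.ι ℂ x) =
      SymmetricAlgebra.ι ℂ _ ((π ∘ₗ constLine.mkQ).lTensor (Cartan Γ) x.1) := by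
  rw [symbol, UniversalEnvelopingAlgebra.lift_ι_apply]
  rfl

theorem symbol_loop (π : H' →ₗ[ℂ] M) (A : Cartan Γ) (f : H) :
    symbol q π (UniversalEnvelopingAlgebra.ι ℂ (Heis.loop q (A ⊗ₜ f))) =
      SymmetricAlgebra.ι ℂ _ (A ⊗ₜ π (constLine.mkQ f)) := symbol_ι q π _

theorem symbol_mode (π : H' →ₗ[ℂ] M) (A : Cartan Γ) (f : H') :
    symbol q π (mode q A f) = SymmetricAlgebra.ι ℂ _ (A ⊗ₜ π f) := by
  rw [mode, symbol_loop, mk_sec]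

theorem symbol_central (π : H' →ₗ[ℂ] M) :
    symbol q π (UniversalEnvelopingAlgebra.ι ℂ (Heis.central q)) = 0 :=
  (symbol_ι q π _).trans
    (map_zero (SymmetricAlgebra.ι ℂ _ ∘ₗ (π ∘ₗ constLine.mkQ).lTensor (Cartan Γ)))

theorem symbol_envHom {π π' : H' →ₗ[ℂ] M} {ρ : SpFull} (h : ∀ f, π' (ρ.1 f) = π f) (u : Env q) :
    symbol q π' (envHom q ρ u) = symbol q π u := by
  have hlift : (π' ∘ₗ constLine.mkQ) ∘ₗ liftH ρ = π ∘ₗ constLine.mkQ :=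
    LinearMap.ext fun f => (congrArg π' (mk_liftH ρ f)).trans (h _)
  induction u using env_induction with
  | algebraMap c => simp only [AlgHom.commutes]
  | mul u v hu hv => simp only [map_mul, hu, hv]
  | add u v hu hv => simp only [map_add, hu, hv]
  | ι x =>
    rw [envHom_ι, symbol_ι, symbol_ι, ← hlift, LinearMap.lTensor_comp (Cartan Γ) _ (liftH ρ)]
    rfl

theorem symbol_surjective {π : H' →ₗ[ℂ] M} (hπ : Function.Surjective π) :
    Function.Surjective (symbol q π) := by
  have hπH : Function.Surjective (π ∘ₗ constLine.mkQ) := hπ.comp constLine.mkQ_surjective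
  intro s
  induction s using SymmetricAlgebra.induction with
  | algebraMap c => exact ⟨algebraMap ℂ _ c, AlgHom.commutes _ c⟩
  | mul a b ha hb =>
    obtain ⟨u, rfl⟩ := ha
    obtain ⟨v, rfl⟩ := hb
    exact ⟨u * v, map_mul _ u v⟩
  | add a b ha hb =>
    obtain ⟨u, rfl⟩ := ha
    obtain ⟨v, rfl⟩ := hb
    exact ⟨u + v, map_add _ u v⟩
  | ι x =>
    obtain ⟨y, rfl⟩ := LinearMap.lTensor_surjective (Cartan Γ) hπH x
    exact ⟨UniversalEnvelopingAlgebra.ι ℂ (Heis.loop q y), symbol_ι q π _⟩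

theorem exists_symbol_action {N : Type*} [AddCommGroup N] [Module (Env q) N] [Module ℂ N]
    [IsScalarTower ℂ (Env q) N] {π : H' →ₗ[ℂ] M} (hπ : Function.Surjective π)
    (hcentral : ∀ n : N, UniversalEnvelopingAlgebra.ι ℂ (Heis.central q) • n = 0)
    (hker : ∀ (A : Cartan Γ) (f : H), π (constLine.mkQ f) = 0 → ∀ n : N,
      UniversalEnvelopingAlgebra.ι ℂ (Heis.loop q (A ⊗ₜ f)) • n = 0) :
    ∃ Φ : SymmetricAlgebra ℂ (Cartan Γ ⊗[ℂ] M) →ₐ[ℂ] Module.End ℂ N,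
      ∀ u n, Φ (symbol q π u) n = u • n := by
  obtain ⟨s, hs⟩ := π.exists_rightInverse_of_surjective (LinearMap.range_eq_top.2 hπ)
  let τ : Cartan Γ ⊗[ℂ] H →ₗ[ℂ] Module.End ℂ N := (Algebra.lsmul ℂ ℂ N).toLinearMap ∘ₗ
    (UniversalEnvelopingAlgebra.ι ℂ : Heis q →ₗ⁅ℂ⁆ Env q).toLinearMap ∘ₗ Heis.loop q
  obtain ⟨Φ, hΦ⟩ := exists_symmetricAlgebra_lift (τ ∘ₗ (sec ∘ₗ s).lTensor (Cartan Γ)) fun _ _ =>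
    LinearMap.ext fun n => smul_smul_comm_of_central q hcentral _ _ n
  have hτ : τ ∘ₗ (sec ∘ₗ s ∘ₗ π ∘ₗ constLine.mkQ).lTensor (Cartan Γ) = τ := by
    refine TensorProduct.ext' fun A f => sub_eq_zero.1 ?_
    rw [LinearMap.comp_apply, LinearMap.lTensor_tmul, ← map_sub, ← TensorProduct.tmul_sub]
    refine LinearMap.ext fun n => hker A _ ?_ n
    rw [map_sub, LinearMap.comp_apply, mk_sec, map_sub, sub_eq_zero]
    exact LinearMap.congr_fun hs _
  refine ⟨Φ, fun u n => ?_⟩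
  induction u using env_induction generalizing n with
  | algebraMap c => rw [AlgHom.commutes, AlgHom.commutes, algebraMap_smul]; rfl
  | mul u v hu hv => rw [map_mul, map_mul, Module.End.mul_apply, hv, hu, mul_smul]
  | add u v hu hv => rw [map_add, map_add, LinearMap.add_apply, hu, hv, add_smul]
  | ι x =>
    have hx := LinearMap.congr_fun hτ x.1
    rw [← LinearMap.comp_assoc, LinearMap.lTensor_comp] at hx
    rw [symbol_ι, hΦ, ι_smul_of_central q hcentral x n]
    exact LinearMap.congr_fun hx n

theorem central_smul (w : Fock q 0) : UniversalEnvelopingAlgebra.ι ℂ (Heis.central q) • w = 0 := by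
  obtain ⟨u, rfl⟩ := (vacIdeal q 0).mkQ_surjective w
  have hcentral : UniversalEnvelopingAlgebra.ι ℂ (Heis.central q) ∈ vacIdeal q 0 := by
    rw [← sub_zero (UniversalEnvelopingAlgebra.ι ℂ (Heis.central q)),
      ← map_zero (algebraMap ℂ (Env q))]
    exact Submodule.subset_span (Or.inr rfl)
  rw [← map_smul, smul_eq_mul, (central_commute q u).eq]
  exact (Submodule.Quotient.mk_eq_zero _).2 (Submodule.smul_mem _ u hcentral)

theorem smul_smul_comm (u v : Env q) (w : Fock q 0) : u • v • w = v • u • w :=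
  smul_smul_comm_of_central q (central_smul q) u v w

theorem smul_vac (u : Env q) (ℓ : ℂ) : u • vac q ℓ = (vacIdeal q ℓ).mkQ u := by
  rw [vac, ← map_smul, smul_eq_mul, mul_one]

theorem exists_smul_vac (ℓ : ℂ) (w : Fock q ℓ) : ∃ u : Env q, u • vac q ℓ = w := by
  obtain ⟨u, rfl⟩ := (vacIdeal q ℓ).mkQ_surjective w
  exact ⟨u, smul_vac q u ℓ⟩

theorem loop_smul_eq_zero (A : Cartan Γ) {f : H} (hf : f ∈ tPow 0) (w : Fock q 0) :
    UniversalEnvelopingAlgebra.ι ℂ (Heis.loop q (A ⊗ₜ f)) • w = 0 := by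
  obtain ⟨u, rfl⟩ := exists_smul_vac q 0 w
  have hvac : UniversalEnvelopingAlgebra.ι ℂ (Heis.loop q (A ⊗ₜ f)) • vac q 0 = 0 := by
    rw [smul_vac]
    exact (Submodule.Quotient.mk_eq_zero _).2 (Submodule.subset_span (Or.inl ⟨A, f, hf, rfl⟩))
  rw [smul_smul_comm, hvac, smul_zero]

theorem mk_mem_Hplus_iff {f : H} : constLine.mkQ f ∈ Hplus ↔ f ∈ tPow 0 := by
  constructor
  · intro hf
    have hsec := mem_tPow.1 (sec_mem_tPow hf)
    refine mem_tPow.2 fun m hm => ?_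
    have hm' := hsec m (by omega)
    rwa [sec_mk, map_sub, map_smul, coeff_bZero, if_neg hm.ne, smul_zero, sub_zero] at hm'
  · intro hf
    refine ⟨_, sub_mem_tPow (mem_tPow.1 hf), ?_⟩
    rw [← sec_mk, mk_sec]

theorem symbol_eq_zero_of_mem_vacIdeal {π : H' →ₗ[ℂ] M} (hπ : ∀ x ∈ Hplus, π x = 0) {u : Env q}
    (hu : u ∈ vacIdeal q 0) : symbol q π u = 0 := by
  induction hu using Submodule.span_induction with
  | zero => exact map_zero _
  | add x y _ _ hx hy => rw [map_add, hx, hy, add_zero]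
  | smul c x _ hx => rw [smul_eq_mul, map_mul, hx, mul_zero]
  | mem x hx =>
    rcases hx with ⟨A, f, hf, rfl⟩ | rfl
    · rw [symbol_loop, hπ _ (mk_mem_Hplus_iff.2 hf), TensorProduct.tmul_zero, map_zero]
    · rw [map_zero, sub_zero, symbol_central]

/-- The map from the Fock space to `Sym(𝔥_Γ ⊗ M)` induced by a linear map `H' → M` that vanishes on
`H'₊`. -/
def fockSymbol (π : H' →ₗ[ℂ] M) (hπ : ∀ x ∈ Hplus, π x = 0) :
    Fock q 0 →ₗ[ℂ] SymmetricAlgebra ℂ (Cartan Γ ⊗[ℂ] M) :=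
  ((vacIdeal q 0).restrictScalars ℂ).liftQ (symbol q π).toLinearMap
    fun _ hu => symbol_eq_zero_of_mem_vacIdeal q hπ hu

theorem fockSymbol_smul_vac (π : H' →ₗ[ℂ] M) (hπ : ∀ x ∈ Hplus, π x = 0) (u : Env q) :
    fockSymbol q π hπ (u • vac q 0) = symbol q π u := by
  rw [smul_vac]
  rfl

theorem fockSymbol_smul (π : H' →ₗ[ℂ] M) (hπ : ∀ x ∈ Hplus, π x = 0) (u : Env q) (w : Fock q 0) :
    fockSymbol q π hπ (u • w) = symbol q π u * fockSymbol q π hπ w := by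
  obtain ⟨v, rfl⟩ := exists_smul_vac q 0 w
  rw [← mul_smul, fockSymbol_smul_vac, fockSymbol_smul_vac, map_mul]

variable {F : Submodule ℂ H'}

theorem smul_mem_outSub (u : Env q) {w : Fock q 0} (hw : w ∈ outSub q 0 F) :
    u • w ∈ outSub q 0 F := by
  induction hw using Submodule.span_induction with
  | zero => rw [smul_zero]; exact Submodule.zero_mem _
  | add x y _ _ hx hy => rw [smul_add]; exact Submodule.add_mem _ hx hy
  | smul c x _ hx => rw [smul_comm]; exact Submodule.smul_mem _ c hx
  | mem x hx =>
    obtain ⟨A, f, w, hf, rfl⟩ := hx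
    exact Submodule.subset_span ⟨A, f, u • w, hf, smul_smul_comm q _ _ w⟩

theorem loop_smul_mem_outSub {A : Cartan Γ} {f : H} (hf : constLine.mkQ f ∈ F ⊔ Hplus)
    (w : Fock q 0) :
    UniversalEnvelopingAlgebra.ι ℂ (Heis.loop q (A ⊗ₜ f)) • w ∈ outSub q 0 F := by
  obtain ⟨a, ha, b, hb, hab⟩ := Submodule.mem_sup.1 hf
  have hsub : f - sec a ∈ tPow 0 := mk_mem_Hplus_iff.1 <| by
    rwa [map_sub, mk_sec, ← hab, add_sub_cancel_left]
  have hmode : UniversalEnvelopingAlgebra.ι ℂ (Heis.loop q (A ⊗ₜ f)) • w = mode q A a • w := by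
    rw [mode, ← sub_eq_zero, ← sub_smul, ← map_sub, ← map_sub, ← TensorProduct.tmul_sub]
    exact loop_smul_eq_zero q A hsub w
  rw [hmode]
  exact Submodule.subset_span ⟨A, a, w, ha, rfl⟩

theorem smul_mem_outSub_of_symbol_eq_zero {π : H' →ₗ[ℂ] M} (hπ : Function.Surjective π)
    (hker : LinearMap.ker π = F ⊔ Hplus) {u : Env q} (hu : symbol q π u = 0) (w : Fock q 0) :
    u • w ∈ outSub q 0 F := by
  let S : Submodule (Env q) (Fock q 0) :=
    { outSub q 0 F with smul_mem' := fun u _ hw => smul_mem_outSub q u hw }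
  have hcentral (n : Fock q 0 ⧸ S) : UniversalEnvelopingAlgebra.ι ℂ (Heis.central q) • n = 0 := by
    obtain ⟨w, rfl⟩ := S.mkQ_surjective n
    rw [← map_smul, central_smul, map_zero]
  have hloop (A : Cartan Γ) (f : H) (hf : π (constLine.mkQ f) = 0) (n : Fock q 0 ⧸ S) :
      UniversalEnvelopingAlgebra.ι ℂ (Heis.loop q (A ⊗ₜ f)) • n = 0 := by
    obtain ⟨w, rfl⟩ := S.mkQ_surjective n
    exact (Submodule.Quotient.mk_eq_zero S).2 (loop_smul_mem_outSub q (hker.le hf) w)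
  obtain ⟨Φ, hΦ⟩ := exists_symbol_action q hπ hcentral hloop
  have hmk : S.mkQ (u • w) = 0 := by
    rw [map_smul, ← hΦ, hu, map_zero, LinearMap.zero_apply]
  exact (Submodule.Quotient.mk_eq_zero S).1 hmk

theorem fockSymbol_eq_zero_iff {π : H' →ₗ[ℂ] M} (hπ : Function.Surjective π)
    (hker : LinearMap.ker π = F ⊔ Hplus) (hplus : ∀ x ∈ Hplus, π x = 0) {w : Fock q 0} :
    fockSymbol q π hplus w = 0 ↔ w ∈ outSub q 0 F := by
  constructor
  · intro hw
    obtain ⟨u, rfl⟩ := exists_smul_vac q 0 w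
    exact smul_mem_outSub_of_symbol_eq_zero q hπ hker ((fockSymbol_smul_vac ..).symm.trans hw) _
  · suffices h : outSub q 0 F ≤ LinearMap.ker (fockSymbol q π hplus) from fun hw => h hw
    refine Submodule.span_le.2 ?_
    rintro _ ⟨A, f, w, hf, rfl⟩
    have hπf : π f = 0 := hker.ge (Submodule.mem_sup_left hf)
    change fockSymbol q π hplus _ = 0
    rw [fockSymbol_smul, symbol_mode, hπf, TensorProduct.tmul_zero, map_zero, zero_mul]

theorem fockSymbol_surjective {π : H' →ₗ[ℂ] M} (hπ : Function.Surjective π)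
    (hplus : ∀ x ∈ Hplus, π x = 0) : Function.Surjective (fockSymbol q π hplus) := fun s => by
  obtain ⟨u, rfl⟩ := symbol_surjective q hπ s
  exact ⟨u • vac q 0, fockSymbol_smul_vac q π hplus u⟩

/-- The isomorphism of the coinvariants for the subspace `F` with `Sym(𝔥_Γ ⊗ M)`, for `H' → M` a
surjection with kernel `F + H'₊`. -/
def coinvEquiv (π : H' →ₗ[ℂ] M) (hπ : Function.Surjective π)
    (hker : LinearMap.ker π = F ⊔ Hplus) :
    ExtCoinv q 0 F ≃ₗ[ℂ] SymmetricAlgebra ℂ (Cartan Γ ⊗[ℂ] M) :=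
  have hplus : ∀ x ∈ Hplus, π x = 0 := fun _ hx => hker.ge (Submodule.mem_sup_right hx)
  (Submodule.quotEquivOfEq _ _
    (Submodule.ext fun _ => (fockSymbol_eq_zero_iff q hπ hker hplus).symm)).trans
    ((fockSymbol q π hplus).quotKerEquivOfSurjective (fockSymbol_surjective q hπ hplus))

theorem coinvEquiv_smul_vac (π : H' →ₗ[ℂ] M) (hπ : Function.Surjective π)
    (hker : LinearMap.ker π = F ⊔ Hplus) (u : Env q) :
    coinvEquiv q π hπ hker ((outSub q 0 F).mkQ (u • vac q 0)) = symbol q π u :=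
  fockSymbol_smul_vac q π (fun _ hx => hker.ge (Submodule.mem_sup_right hx)) u

theorem coinvEquiv_monomial (π : H' →ₗ[ℂ] M) (hπ : Function.Surjective π)
    (hker : LinearMap.ker π = F ⊔ Hplus) (l : List (Cartan Γ × H')) :
    coinvEquiv q π hπ hker ((outSub q 0 F).mkQ (monomial q 0 l)) =
      (l.map fun p => SymmetricAlgebra.ι ℂ _ (p.1 ⊗ₜ[ℂ] π p.2)).prod := by
  rw [monomial, coinvEquiv_smul_vac, map_list_prod, List.map_map]
  exact congrArg List.prod (List.map_congr_left fun p _ => symbol_mode q π p.1 p.2)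

theorem coinvEquiv_coinvMap {F' : Submodule ℂ H'} {π π' : H' →ₗ[ℂ] M}
    (hπ : Function.Surjective π) (hker : LinearMap.ker π = F ⊔ Hplus)
    (hπ' : Function.Surjective π') (hker' : LinearMap.ker π' = F' ⊔ Hplus) {ρ : SpFull}
    (hρ : ∀ f, π' (ρ.1 f) = π f) (hF : ∀ f, ρ.1 f ∈ F' ↔ f ∈ F) (c : ExtCoinv q 0 F) :
    coinvEquiv q π' hπ' hker' (coinvMap q ρ 0 hF c) = coinvEquiv q π hπ hker c := by
  obtain ⟨w, rfl⟩ := (outSub q 0 F).mkQ_surjective c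
  obtain ⟨u, rfl⟩ := exists_smul_vac q 0 w
  have hmap : coinvMap q ρ 0 hF ((outSub q 0 F).mkQ (u • vac q 0)) =
      (outSub q 0 F').mkQ (envHom q ρ u • vac q 0) := by
    change (outSub q 0 F').mkQ (fockMap q ρ 0 (u • vac q 0)) = _
    rw [fockMap_smul, fockMap_vac]
  rw [hmap, coinvEquiv_smul_vac, coinvEquiv_smul_vac, symbol_envHom q hρ]

end Fock

/-! ### One-forms on a complex torus -/

section OneForms

variable {W : Type*} [NormedAddCommGroup W] [NormedSpace ℂ W] [FiniteDimensional ℂ W] (P : PPAV W)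

theorem PPAV.oneForm_eq (η : P.OneForms) (y : P.X) : η.1 y = η.1 0 := by
  have := P.discrete
  have := P.isZLattice
  have := FiniteDimensional.complexToReal W
  have hη : Differentiable ℂ fun w : W => η.1 (P.Λ.mkQ w) := η.2
  have hperiodic (z w : W) (hw : w ∈ P.Λ) : η.1 (P.Λ.mkQ (z + w)) = η.1 (P.Λ.mkQ z) := by
    rw [map_add, show P.Λ.mkQ w = 0 from (Submodule.Quotient.mk_eq_zero _).2 hw, add_zero]
  have hcompact := IsZLattice.isCompact_range_of_periodic P.Λ (fun w : W => η.1 (P.Λ.mkQ w))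
    hη.continuous hperiodic
  obtain ⟨w, rfl⟩ := P.Λ.mkQ_surjective y
  exact (hη.apply_eq_apply_of_bounded hcompact.isBounded w 0).trans (by rw [map_zero])

/-- Evaluation at the origin identifies the one-forms on a complex torus with the linear forms on
its tangent space. -/
def PPAV.oneFormsEquiv : P.OneForms ≃ₗ[ℂ] Module.Dual ℂ W where
  toFun η := (η.1 0).toLinearMap
  map_add' _ _ := rfl
  map_smul' _ _ := rfl
  invFun φ := ⟨fun _ => LinearMap.toContinuousLinearMap φ, differentiable_const _⟩
  left_inv η := Subtype.ext (funext fun y => by rw [P.oneForm_eq η y]; rfl)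
  right_inv _ := rfl

instance PPAV.finite_oneForms : FiniteDimensional ℂ P.OneForms :=
  Module.Finite.equiv P.oneFormsEquiv.symm

theorem PPAV.tangentToDual_bijective : Function.Bijective P.tangentToDual :=
  ((Module.evalEquiv ℂ W).trans P.oneFormsEquiv.dualMap).bijective

end OneForms

/-! ### Polynomial functions and the symmetric algebra -/

section SymmetricAlgebra

variable {R D M : Type*} [CommRing R] [AddCommMonoid D] [Module R D] [AddCommMonoid M] [Module R M]

/-- The isomorphism of symmetric algebras induced by a linear isomorphism. -/
def symCongr (e : D ≃ₗ[R] M) : SymmetricAlgebra R D ≃ₐ[R] SymmetricAlgebra R M :=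
  AlgEquiv.ofAlgHom (SymmetricAlgebra.lift (SymmetricAlgebra.ι R M ∘ₗ e.toLinearMap))
    (SymmetricAlgebra.lift (SymmetricAlgebra.ι R D ∘ₗ e.symm.toLinearMap))
    (SymmetricAlgebra.algHom_ext (LinearMap.ext fun x => by simp))
    (SymmetricAlgebra.algHom_ext (LinearMap.ext fun x => by simp))

theorem symCongr_ι (e : D ≃ₗ[R] M) (d : D) :
    symCongr e (SymmetricAlgebra.ι R D d) = SymmetricAlgebra.ι R M (e d) :=
  SymmetricAlgebra.lift_ι_apply _ d

theorem adjoin_range_ι_eq_top {I : Type*} {t : I → M} (ht : Submodule.span R (Set.range t) = ⊤) :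
    Algebra.adjoin R (Set.range fun i => SymmetricAlgebra.ι R M (t i)) = ⊤ := by
  refine eq_top_iff.2 fun s _ => ?_
  induction s using SymmetricAlgebra.induction with
  | algebraMap c => exact Subalgebra.algebraMap_mem _ c
  | mul a b ha hb => exact Subalgebra.mul_mem _ (ha trivial) (hb trivial)
  | add a b ha hb => exact Subalgebra.add_mem _ (ha trivial) (hb trivial)
  | ι x =>
    have hx : x ∈ Submodule.span R (Set.range t) := ht.ge Submodule.mem_top
    have hιx := Submodule.mem_map_of_mem (f := SymmetricAlgebra.ι R M) hx
    rw [Submodule.map_span, ← Set.range_comp] at hιx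
    exact Algebra.span_le_adjoin R _ hιx

theorem span_list_prod_eq_top {I : Type*} {t : I → M} (ht : Submodule.span R (Set.range t) = ⊤) :
    Submodule.span R (Set.range fun l : List I =>
      (l.map fun i => SymmetricAlgebra.ι R M (t i)).prod) = ⊤ := by
  rw [← Algebra.top_toSubmodule, ← adjoin_range_ι_eq_top ht, Algebra.adjoin_eq_span,
    ← FreeMonoid.mrange_lift, MonoidHom.coe_mrange]
  exact congrArg _ (congrArg Set.range (funext fun l => (FreeMonoid.lift_apply _ l).symm))

section Functions

variable {E : Type*} [AddCommGroup E] [Module R E]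

/-- The homomorphism from the symmetric algebra to functions on `E` induced by a linear map to the
dual of `E`. -/
def symToFun (θ : D →ₗ[R] Module.Dual R E) : SymmetricAlgebra R D →ₐ[R] (E → R) :=
  SymmetricAlgebra.lift (LinearMap.ltoFun R E R R ∘ₗ θ)

theorem symToFun_ι (θ : D →ₗ[R] Module.Dual R E) (d : D) :
    symToFun θ (SymmetricAlgebra.ι R D d) = θ d := SymmetricAlgebra.lift_ι_apply _ d

theorem symToFun_apply {κ : Type*} [Finite κ] [DecidableEq κ] (b : Module.Basis κ R E)
    (θ : D ≃ₗ[R] Module.Dual R E) (s : SymmetricAlgebra R D) (e : E) :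
    symToFun θ.toLinearMap s e = MvPolynomial.aeval (b.equivFun e)
      (SymmetricAlgebra.equivMvPolynomial (b.dualBasis.map θ.symm) s) := by
  suffices h : (Pi.evalAlgHom R (fun _ : E => R) e).comp (symToFun θ.toLinearMap) =
      (MvPolynomial.aeval (b.equivFun e)).comp
        (SymmetricAlgebra.equivMvPolynomial (b.dualBasis.map θ.symm) : _ →ₐ[R] _) from
    AlgHom.congr_fun h s
  refine SymmetricAlgebra.algHom_ext ((b.dualBasis.map θ.symm).ext fun i => ?_)
  change symToFun θ.toLinearMap (SymmetricAlgebra.ι R D (b.dualBasis.map θ.symm i)) e =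
    MvPolynomial.aeval (b.equivFun e) (SymmetricAlgebra.equivMvPolynomial (b.dualBasis.map θ.symm)
      (SymmetricAlgebra.ι R D (b.dualBasis.map θ.symm i)))
  rw [symToFun_ι, SymmetricAlgebra.equivMvPolynomial_ι_apply, MvPolynomial.aeval_X]
  simp only [Module.Basis.map_apply, LinearEquiv.coe_coe, LinearEquiv.apply_symm_apply,
    Module.Basis.dualBasis_apply, Module.Basis.equivFun_apply]

theorem symToFun_injective [IsDomain R] [Infinite R] [Module.Free R E] [Module.Finite R E]
    (θ : D ≃ₗ[R] Module.Dual R E) : Function.Injective (symToFun θ.toLinearMap) := by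
  classical
  let b := Module.Free.chooseBasis R E
  intro s s' h
  refine (SymmetricAlgebra.equivMvPolynomial (b.dualBasis.map θ.symm)).injective
    (MvPolynomial.funext fun y => ?_)
  have hy := congrFun h (b.equivFun.symm y)
  rwa [symToFun_apply b, symToFun_apply b, LinearEquiv.apply_symm_apply] at hy

end Functions

end SymmetricAlgebra

section PolynomialFunctions

variable {D E : Type*} [AddCommMonoid D] [Module ℂ D] [AddCommGroup E] [Module ℂ E]

theorem range_symToFun (θ : D ≃ₗ[ℂ] Module.Dual ℂ E) :
    (symToFun θ.toLinearMap).range = Fun E := by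
  have hι : Algebra.adjoin ℂ (Set.range fun d => SymmetricAlgebra.ι ℂ D d) = ⊤ :=
    adjoin_range_ι_eq_top (t := id) (by rw [Set.range_id, Submodule.span_univ])
  rw [← Algebra.map_top, ← hι, AlgHom.map_adjoin, ← Set.range_comp, Fun]
  congr 1
  ext φ
  simp only [Set.mem_range, Function.comp_apply, symToFun_ι, LinearEquiv.coe_coe,
    θ.surjective.exists, Set.mem_ofPred_eq, eq_comm]

variable [FiniteDimensional ℂ E]

/-- The isomorphism of the symmetric algebra of the dual of a finite-dimensional space with its ring
of polynomial functions. -/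
def symFunEquiv (θ : D ≃ₗ[ℂ] Module.Dual ℂ E) : SymmetricAlgebra ℂ D ≃ₐ[ℂ] Fun E :=
  (AlgEquiv.ofInjective _ (symToFun_injective θ)).trans
    (Subalgebra.equivOfEq _ _ (range_symToFun θ))

theorem symFunEquiv_list_prod (θ : D ≃ₗ[ℂ] Module.Dual ℂ E) {I : Type*} (l : List I) (d : I → D)
    (e : E) : (symFunEquiv θ (l.map fun i => SymmetricAlgebra.ι ℂ D (d i)).prod).1 e =
      (l.map fun i => θ (d i) e).prod := by
  change Pi.evalMonoidHom (fun _ : E => ℂ) e (symToFun θ.toLinearMap _) = _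
  rw [map_list_prod, map_list_prod, List.map_map, List.map_map]
  exact congrArg List.prod (List.map_congr_left fun i _ => congrFun (symToFun_ι _ (d i)) e)

end PolynomialFunctions

/-! ### Nondegeneracy of the form on the Cartan algebra -/

section Cartan

variable {Γ : Type*} [AddCommGroup Γ] [Module.Free ℤ Γ] [Module.Finite ℤ Γ] (q : EvenLattice Γ)

theorem cartanForm_nondegenerate : (cartanForm q).Nondegenerate := by
  classical
  let b := Module.Free.chooseBasis ℤ Γ
  have hq : q.q.Nondegenerate :=
    ⟨fun x hx => by_contra fun h => (q.positive x h).ne' (hx x),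
      fun x hx => by_contra fun h => (q.positive x h).ne' (hx x)⟩
  have hmatrix : LinearMap.BilinForm.toMatrix (Algebra.TensorProduct.basis ℂ b) (cartanForm q) =
      (LinearMap.BilinForm.toMatrix b q.q).map fun n => (n : ℂ) := by
    ext i j
    simp [LinearMap.BilinForm.toMatrix_apply, cartanForm, LinearMap.BilinForm.baseChange_tmul]
  rw [LinearMap.BilinForm.nondegenerate_iff_det_ne_zero b] at hq
  rw [LinearMap.BilinForm.nondegenerate_iff_det_ne_zero (Algebra.TensorProduct.basis ℂ b), hmatrix,
    ← Int.cast_det]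
  exact Int.cast_ne_zero.2 hq

variable {M : Type*} [AddCommGroup M] [Module ℂ M] [FiniteDimensional ℂ M]

/-- The perfect pairing between `𝔥_Γ ⊗ M^*` and `𝔥_Γ ⊗ M`. -/
def pairingEquiv : Cartan Γ ⊗[ℂ] Module.Dual ℂ M ≃ₗ[ℂ] Module.Dual ℂ (Cartan Γ ⊗[ℂ] M) :=
  (TensorProduct.congr ((cartanForm q).toDual (cartanForm_nondegenerate q))
    (LinearEquiv.refl ℂ (Module.Dual ℂ M))).trans (TensorProduct.dualDistribEquiv ℂ (Cartan Γ) M)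

theorem pairingEquiv_tmul (A : Cartan Γ) (u : Module.Dual ℂ M) :
    pairingEquiv q (A ⊗ₜ u) = pairing q A u := by
  refine TensorProduct.ext' fun B m => ?_
  change TensorProduct.dualDistrib ℂ (Cartan Γ) M
    ((cartanForm q).toDual (cartanForm_nondegenerate q) A ⊗ₜ u) (B ⊗ₜ m) = _
  rw [TensorProduct.dualDistrib_apply, LinearMap.BilinForm.toDual_def]
  rfl

end Cartan

/-! ### Coinvariants of a PPAV -/

section Coinvariants

variable {Γ : Type*} [AddCommGroup Γ] (q : EvenLattice Γ)
  {W : Type*} [NormedAddCommGroup W] [NormedSpace ℂ W] {P : PPAV W}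

namespace Sp

/-- The extension by `0` on `H'₊` of the map `Z → H⁰(X, Ω¹)^*`. -/
def extDual (x : Sp P) : H' →ₗ[ℂ] Module.Dual ℂ P.OneForms :=
  x.toDual ∘ₗ x.a.Z.projectionOnto Hplus x.isLagrangianComplement.isCompl

theorem extDual_coe (x : Sp P) (z : x.a.Z) : x.extDual z.1 = x.toDual z := by
  rw [extDual, LinearMap.comp_apply, Submodule.projectionOnto_apply_left]

theorem extDual_of_mem_Hplus (x : Sp P) {k : H'} (hk : k ∈ Hplus) : x.extDual k = 0 := by
  rw [extDual, LinearMap.comp_apply, Submodule.projectionOnto_apply_of_mem_right _ hk, map_zero]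

theorem extDual_moves {x x' : Sp P} {ρ : SpFull} (h : Moves ρ x x') (f : H') :
    x'.extDual (ρ.1 f) = x.extDual f := by
  obtain ⟨z, k, rfl⟩ := x.isLagrangianComplement.exists_add_eq f
  have hz : ρ.1 z.1 ∈ x'.a.Z := (h.map_Z z.1).2 z.2
  rw [map_add, map_add, map_add, x.extDual_of_mem_Hplus k.2,
    x'.extDual_of_mem_Hplus ((ρ.2.2.2.2 k.1).2 k.2), add_zero, add_zero, extDual_coe,
    x'.extDual_coe ⟨_, hz⟩]
  exact congrArg P.tangentToDual (h.map_iso z ⟨_, hz⟩ rfl)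

variable [FiniteDimensional ℂ W]

theorem toDual_surjective (x : Sp P) : Function.Surjective x.toDual :=
  P.tangentToDual_bijective.surjective.comp x.proj_surjective

theorem toDual_eq_zero_iff (x : Sp P) (z : x.a.Z) : x.toDual z = 0 ↔ z.1 ∈ x.a.F := by
  rw [← x.proj_eq_zero_iff]
  exact map_eq_zero_iff P.tangentToDual P.tangentToDual_bijective.injective

theorem extDual_surjective (x : Sp P) : Function.Surjective x.extDual :=
  x.toDual_surjective.comp (Submodule.projectionOnto_surjective _)

theorem ker_extDual (x : Sp P) : LinearMap.ker x.extDual = x.a.F ⊔ Hplus := by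
  refine le_antisymm (fun f hf => ?_)
    (sup_le (fun f hf => ?_) fun f hf => x.extDual_of_mem_Hplus hf)
  · obtain ⟨z, k, rfl⟩ := x.isLagrangianComplement.exists_add_eq f
    rw [LinearMap.mem_ker, map_add, x.extDual_of_mem_Hplus k.2, add_zero, extDual_coe,
      toDual_eq_zero_iff] at hf
    exact Submodule.add_mem_sup hf k.2
  · rw [LinearMap.mem_ker, x.extDual_coe ⟨f, x.a.F_le hf⟩]
    exact (x.toDual_eq_zero_iff _).2 hf

/-- The isomorphism of the coinvariants at a point of `Sp(X, Θ)` with `Sym(𝔥_Γ ⊗ H⁰(X, Ω¹)^*)`. -/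
def fiberEquiv (x : Sp P) :
    ExtCoinv q 0 x.a.F ≃ₗ[ℂ] SymmetricAlgebra ℂ (Cartan Γ ⊗[ℂ] Module.Dual ℂ P.OneForms) :=
  coinvEquiv q x.extDual x.extDual_surjective x.ker_extDual

theorem fiberEquiv_monomial (x : Sp P) (l : List (Cartan Γ × x.a.Z)) :
    x.fiberEquiv q ((outSub q 0 x.a.F).mkQ (monomial q 0 (l.map fun p => (p.1, p.2.1)))) =
      (l.map fun p => SymmetricAlgebra.ι ℂ _ (p.1 ⊗ₜ[ℂ] x.toDual p.2)).prod := by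
  rw [fiberEquiv, coinvEquiv_monomial, List.map_map]
  exact congrArg List.prod
    (List.map_congr_left fun p _ => by rw [Function.comp_apply, extDual_coe])

theorem fiberEquiv_moves {x x' : Sp P} {ρ : SpFull} (h : Moves ρ x x') (c : ExtCoinv q 0 x.a.F) :
    x'.fiberEquiv q (coinvMap q ρ 0 h.map_F c) = x.fiberEquiv q c :=
  coinvEquiv_coinvMap q _ _ _ _ (extDual_moves h) _ c

theorem span_tmul_toDual (x : Sp P) : Submodule.span ℂ (Set.range fun p : Cartan Γ × x.a.Z =>
    p.1 ⊗ₜ[ℂ] x.toDual p.2) = ⊤ := by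
  rw [← TensorProduct.span_tmul_eq_top ℂ (Cartan Γ) (Module.Dual ℂ P.OneForms)]
  congr 1
  ext t
  simp only [Set.mem_range, Prod.exists, Set.mem_ofPred_eq, x.toDual_surjective.exists]

theorem span_tmul_toDual_of_span_singleton {h : Cartan Γ} (hspan : Submodule.span ℂ {h} = ⊤)
    (x : Sp P) : Submodule.span ℂ (Set.range fun z : x.a.Z => h ⊗ₜ[ℂ] x.toDual z) = ⊤ := by
  rw [eq_top_iff, ← x.span_tmul_toDual (Γ := Γ), Submodule.span_le]
  rintro _ ⟨⟨A, z⟩, rfl⟩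
  obtain ⟨c, rfl⟩ := Submodule.mem_span_singleton.1 (hspan.ge (Submodule.mem_top (x := A)))
  refine Submodule.subset_span ⟨c • z, ?_⟩
  simp only [map_smul, TensorProduct.tmul_smul, TensorProduct.smul_tmul']

end Sp

variable [FiniteDimensional ℂ W]

theorem fiberEquiv_eq (v : Coinv q 0 P) (x x' : Sp P) :
    x'.fiberEquiv q (v.1 x') = x.fiberEquiv q (v.1 x) := by
  obtain ⟨ρ, hρ, h⟩ := Sp.exists_moves x x'
  rw [← v.2 ρ hρ x x' h, Sp.fiberEquiv_moves q h]

theorem eval_bijective (x : Sp P) : Function.Bijective fun v : Coinv q 0 P => v.1 x := by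
  constructor
  · intro v w hvw
    refine Subtype.ext (funext fun x' => (x'.fiberEquiv q).injective ?_)
    rw [fiberEquiv_eq q v x, fiberEquiv_eq q w x]
    exact congrArg _ hvw
  · intro c
    refine ⟨⟨fun x' => (x'.fiberEquiv q).symm (x.fiberEquiv q c), fun ρ _ y y' h => ?_⟩,
      LinearEquiv.symm_apply_apply _ c⟩
    refine (y'.fiberEquiv q).injective ?_
    rw [Sp.fiberEquiv_moves q h, LinearEquiv.apply_symm_apply, LinearEquiv.apply_symm_apply]

variable (P) in
/-- The canonical isomorphism of the coinvariants with `Sym(𝔥_Γ ⊗ H⁰(X, Ω¹)^*)`. -/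
def canonicalEquiv :
    Coinv q 0 P ≃ₗ[ℂ] SymmetricAlgebra ℂ (Cartan Γ ⊗[ℂ] Module.Dual ℂ P.OneForms) :=
  (LinearEquiv.ofBijective
    (LinearMap.proj (φ := fun x : Sp P => ExtCoinv q 0 x.a.F) (nonempty_Sp P).some ∘ₗ
      (Coinv q 0 P).subtype)
    (eval_bijective q (nonempty_Sp P).some)).trans ((nonempty_Sp P).some.fiberEquiv q)

theorem canonicalEquiv_apply (v : Coinv q 0 P) (x : Sp P) :
    canonicalEquiv q P v = x.fiberEquiv q (v.1 x) :=
  fiberEquiv_eq q v x (nonempty_Sp P).some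

theorem canonicalEquiv_of_monomial {v : Coinv q 0 P} {x : Sp P} {l : List (Cartan Γ × x.a.Z)}
    (h : v.1 x = (outSub q 0 x.a.F).mkQ (monomial q 0 (l.map fun p => (p.1, p.2.1)))) :
    canonicalEquiv q P v =
      (l.map fun p => SymmetricAlgebra.ι ℂ _ (p.1 ⊗ₜ[ℂ] x.toDual p.2)).prod := by
  rw [canonicalEquiv_apply q v x, h, Sp.fiberEquiv_monomial]

theorem linearEquiv_ext_of_monomial {V : Type*} [AddCommGroup V] [Module ℂ V] (x : Sp P)
    {I : Type*} {a : I → Cartan Γ × x.a.Z}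
    (ha : Submodule.span ℂ (Set.range fun i => (a i).1 ⊗ₜ[ℂ] x.toDual (a i).2) = ⊤)
    {G G' : Coinv q 0 P ≃ₗ[ℂ] V}
    (h : ∀ (v : Coinv q 0 P) (l : List I), v.1 x =
      (outSub q 0 x.a.F).mkQ (monomial q 0 (l.map fun i => ((a i).1, (a i).2.1))) → G v = G' v) :
    G = G' := by
  let C := canonicalEquiv q P
  suffices hC : G.toLinearMap ∘ₗ C.symm.toLinearMap = G'.toLinearMap ∘ₗ C.symm.toLinearMap from
    LinearEquiv.toLinearMap_injective ((LinearMap.cancel_right C.symm.surjective).1 hC)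
  refine LinearMap.ext_on (span_list_prod_eq_top ha) ?_
  rintro _ ⟨l, rfl⟩
  refine h _ l ((x.fiberEquiv q).injective ?_)
  have hmonomial := x.fiberEquiv_monomial q (l.map a)
  rw [List.map_map, List.map_map] at hmonomial
  rw [← canonicalEquiv_apply]
  exact (C.apply_symm_apply _).trans hmonomial.symm

variable (P) in
theorem existsUnique_canonicalEquiv : ∃! Φ : Coinv q 0 P ≃ₗ[ℂ]
      SymmetricAlgebra ℂ (Cartan Γ ⊗[ℂ] Module.Dual ℂ P.OneForms),
    ∀ (v : Coinv q 0 P) (x : Sp P) (l : List (Cartan Γ × x.a.Z)),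
      v.1 x = (outSub q 0 x.a.F).mkQ (monomial q 0 (l.map fun p => (p.1, p.2.1))) →
      Φ v = (l.map fun p => SymmetricAlgebra.ι ℂ _ (p.1 ⊗ₜ[ℂ] x.toDual p.2)).prod := by
  obtain ⟨x₀⟩ := nonempty_Sp P
  refine ⟨canonicalEquiv q P, fun v x l hv => canonicalEquiv_of_monomial q hv, fun Φ hΦ => ?_⟩
  refine linearEquiv_ext_of_monomial q x₀ x₀.span_tmul_toDual fun v l hv => ?_
  exact (hΦ v x₀ l hv).trans (canonicalEquiv_of_monomial q hv).symm

section PolynomialFunctions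

variable [Module.Free ℤ Γ] [Module.Finite ℤ Γ]

variable (P) in
/-- The canonical isomorphism of the coinvariants with the polynomial functions on
`𝔥_Γ ⊗ H⁰(X, Ω¹)`. -/
def canonicalFunEquiv : Coinv q 0 P ≃ₗ[ℂ] Fun (Cartan Γ ⊗[ℂ] P.OneForms) :=
  (canonicalEquiv q P).trans
    (symFunEquiv (E := Cartan Γ ⊗[ℂ] P.OneForms) (pairingEquiv q (M := P.OneForms))).toLinearEquiv

theorem canonicalFunEquiv_of_monomial {v : Coinv q 0 P} {x : Sp P} {l : List (Cartan Γ × x.a.Z)}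
    (h : v.1 x = (outSub q 0 x.a.F).mkQ (monomial q 0 (l.map fun p => (p.1, p.2.1))))
    (y : Cartan Γ ⊗[ℂ] P.OneForms) :
    (canonicalFunEquiv q P v).1 y = (l.map fun p => pairing q p.1 (x.toDual p.2) y).prod := by
  change (symFunEquiv (E := Cartan Γ ⊗[ℂ] P.OneForms) (pairingEquiv q (M := P.OneForms))
    (canonicalEquiv q P v)).1 y = _
  rw [canonicalEquiv_of_monomial q h, symFunEquiv_list_prod]
  simp only [pairingEquiv_tmul]

variable (P) in
theorem existsUnique_canonicalFunEquiv :
    ∃! Ψ : Coinv q 0 P ≃ₗ[ℂ] Fun (Cartan Γ ⊗[ℂ] P.OneForms),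
      ∀ (v : Coinv q 0 P) (x : Sp P) (l : List (Cartan Γ × x.a.Z)),
        v.1 x = (outSub q 0 x.a.F).mkQ (monomial q 0 (l.map fun p => (p.1, p.2.1))) →
        ∀ y : Cartan Γ ⊗[ℂ] P.OneForms,
          (Ψ v).1 y = (l.map fun p => pairing q p.1 (x.toDual p.2) y).prod := by
  obtain ⟨x₀⟩ := nonempty_Sp P
  refine ⟨canonicalFunEquiv q P, fun v x l hv => canonicalFunEquiv_of_monomial q hv,
    fun Ψ hΨ => ?_⟩
  refine linearEquiv_ext_of_monomial q x₀ x₀.span_tmul_toDual fun v l hv =>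
    Subtype.ext (funext fun y => ?_)
  exact (hΨ v x₀ l hv y).trans (canonicalFunEquiv_of_monomial q hv y).symm

end PolynomialFunctions

section RankOne

/-- The isomorphism `M ≅ 𝔥_Γ ⊗ M` given by a vector that spans `𝔥_Γ`. -/
def tmulEquiv {h : Cartan Γ} (h0 : h ≠ 0) (hspan : Submodule.span ℂ {h} = ⊤) (M : Type*)
    [AddCommGroup M] [Module ℂ M] : M ≃ₗ[ℂ] Cartan Γ ⊗[ℂ] M :=
  (TensorProduct.lid ℂ M).symm.trans <| (LinearEquiv.ofBijective
    (LinearMap.toSpanSingleton ℂ (Cartan Γ) h) ⟨smul_left_injective ℂ h0, fun _ =>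
      Submodule.mem_span_singleton.1 (hspan.ge Submodule.mem_top)⟩).rTensor M

variable {h : Cartan Γ} (h0 : h ≠ 0) (hspan : Submodule.span ℂ {h} = ⊤)

theorem tmulEquiv_apply {M : Type*} [AddCommGroup M] [Module ℂ M] (m : M) :
    tmulEquiv h0 hspan M m = h ⊗ₜ m := by
  change ((1 : ℂ) • h) ⊗ₜ[ℂ] m = _
  rw [one_smul]

variable (P) in
/-- The isomorphism of the coinvariants with `Sym(H⁰(X, Ω¹)^*)` given by a vector that spans
`𝔥_Γ`. -/
def rankOneEquiv : Coinv q 0 P ≃ₗ[ℂ] SymmetricAlgebra ℂ (Module.Dual ℂ P.OneForms) :=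
  (canonicalEquiv q P).trans
    (symCongr (tmulEquiv h0 hspan (Module.Dual ℂ P.OneForms)).symm).toLinearEquiv

theorem rankOneEquiv_of_monomial {v : Coinv q 0 P} {x : Sp P} {l : List x.a.Z}
    (hv : v.1 x = (outSub q 0 x.a.F).mkQ (monomial q 0 (l.map fun f => (h, f.1)))) :
    rankOneEquiv q P h0 hspan v = (l.map fun f => SymmetricAlgebra.ι ℂ _ (x.toDual f)).prod := by
  have hv' : v.1 x = (outSub q 0 x.a.F).mkQ
      (monomial q 0 ((l.map fun f => (h, f)).map fun p => (p.1, p.2.1))) := by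
    rw [hv, List.map_map]
    rfl
  have hsymm (f : x.a.Z) :
      symCongr (tmulEquiv h0 hspan (Module.Dual ℂ P.OneForms)).symm
        (SymmetricAlgebra.ι ℂ _ (h ⊗ₜ x.toDual f)) = SymmetricAlgebra.ι ℂ _ (x.toDual f) := by
    rw [symCongr_ι, ← tmulEquiv_apply h0 hspan, LinearEquiv.symm_apply_apply]
  change symCongr (tmulEquiv h0 hspan (Module.Dual ℂ P.OneForms)).symm (canonicalEquiv q P v) = _
  rw [canonicalEquiv_of_monomial q hv', map_list_prod, List.map_map, List.map_map]
  exact congrArg List.prod (List.map_congr_left fun f _ => hsymm f)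

include h0 hspan in
variable (P) in
theorem existsUnique_rankOneEquiv :
    ∃! Φ : Coinv q 0 P ≃ₗ[ℂ] SymmetricAlgebra ℂ (Module.Dual ℂ P.OneForms),
      ∀ (v : Coinv q 0 P) (x : Sp P) (l : List x.a.Z),
        v.1 x = (outSub q 0 x.a.F).mkQ (monomial q 0 (l.map fun f => (h, f.1))) →
        Φ v = (l.map fun f => SymmetricAlgebra.ι ℂ _ (x.toDual f)).prod := by
  obtain ⟨x₀⟩ := nonempty_Sp P
  refine ⟨rankOneEquiv q P h0 hspan, fun v x l hv => rankOneEquiv_of_monomial q h0 hspan hv,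
    fun Φ hΦ => ?_⟩
  refine linearEquiv_ext_of_monomial q x₀ (a := fun z => (h, z))
    (x₀.span_tmul_toDual_of_span_singleton hspan) fun v l hv => ?_
  exact (hΦ v x₀ l hv).trans (rankOneEquiv_of_monomial q h0 hspan hv).symm

variable (P) in
/-- The isomorphism of the coinvariants with the polynomial functions on `H⁰(X, Ω¹)` given by a
vector that spans `𝔥_Γ`. -/
def rankOneFunEquiv : Coinv q 0 P ≃ₗ[ℂ] Fun P.OneForms :=
  (rankOneEquiv q P h0 hspan).trans
    (symFunEquiv (E := P.OneForms) (LinearEquiv.refl ℂ (Module.Dual ℂ P.OneForms))).toLinearEquiv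

theorem rankOneFunEquiv_of_monomial {v : Coinv q 0 P} {x : Sp P} {l : List x.a.Z}
    (hv : v.1 x = (outSub q 0 x.a.F).mkQ (monomial q 0 (l.map fun f => (h, f.1))))
    (η : P.OneForms) :
    (rankOneFunEquiv q P h0 hspan v).1 η = (l.map fun f => x.toDual f η).prod := by
  change (symFunEquiv (LinearEquiv.refl ℂ (Module.Dual ℂ P.OneForms))
    (rankOneEquiv q P h0 hspan v)).1 η = _
  rw [rankOneEquiv_of_monomial q h0 hspan hv, symFunEquiv_list_prod]
  rfl

include h0 hspan in
variable (P) in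
theorem existsUnique_rankOneFunEquiv :
    ∃! Ψ : Coinv q 0 P ≃ₗ[ℂ] Fun P.OneForms,
      ∀ (v : Coinv q 0 P) (x : Sp P) (l : List x.a.Z),
        v.1 x = (outSub q 0 x.a.F).mkQ (monomial q 0 (l.map fun f => (h, f.1))) →
        ∀ η : P.OneForms, (Ψ v).1 η = (l.map fun f => x.toDual f η).prod := by
  obtain ⟨x₀⟩ := nonempty_Sp P
  refine ⟨rankOneFunEquiv q P h0 hspan,
    fun v x l hv => rankOneFunEquiv_of_monomial q h0 hspan hv, fun Ψ hΨ => ?_⟩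
  refine linearEquiv_ext_of_monomial q x₀ (a := fun z => (h, z))
    (x₀.span_tmul_toDual_of_span_singleton hspan) fun v l hv => Subtype.ext (funext fun η => ?_)
  exact (hΨ v x₀ l hv η).trans (rankOneFunEquiv_of_monomial q h0 hspan hv η).symm

end RankOne

end Coinvariants

end AbelianCoinvariants

end

theorem theorem5p4 {Γ : Type*} [AddCommGroup Γ] [Module.Free ℤ Γ] [Module.Finite ℤ Γ]
    (q : EvenLattice Γ)
    {W : Type*} [NormedAddCommGroup W] [NormedSpace ℂ W] [FiniteDimensional ℂ W]
    (P : PPAV W) :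
    -- the descended space has the coinvariants at each point of `Sp(X, Θ)` as its fiber
    (∀ x : Sp P, Function.Bijective fun v : Coinv q 0 P => v.1 x) ∧
    -- the canonical isomorphism with `Sym(𝔥_Γ ⊗ H⁰(X, Ω¹)^*)`
    (∃! Φ : Coinv q 0 P ≃ₗ[ℂ]
          SymmetricAlgebra ℂ (Cartan Γ ⊗[ℂ] Module.Dual ℂ P.OneForms),
        ∀ (v : Coinv q 0 P) (x : Sp P) (l : List (Cartan Γ × x.a.Z)),
          v.1 x = (outSub q 0 x.a.F).mkQ (monomial q 0 (l.map fun p => (p.1, p.2.1))) →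
          Φ v = (l.map fun p => SymmetricAlgebra.ι ℂ _ (p.1 ⊗ₜ[ℂ] x.toDual p.2)).prod) ∧
    -- the canonical isomorphism with `Fun(𝔥_Γ ⊗ H⁰(X, Ω¹))`
    (∃! Ψ : Coinv q 0 P ≃ₗ[ℂ] Fun (Cartan Γ ⊗[ℂ] P.OneForms),
        ∀ (v : Coinv q 0 P) (x : Sp P) (l : List (Cartan Γ × x.a.Z)),
          v.1 x = (outSub q 0 x.a.F).mkQ (monomial q 0 (l.map fun p => (p.1, p.2.1))) →
          ∀ y : Cartan Γ ⊗[ℂ] P.OneForms,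
            (Ψ v).1 y = (l.map fun p => pairing q p.1 (x.toDual p.2) y).prod) ∧
    -- the case of rank one, where `𝔥_Γ` is spanned by a vector `h` with `(h, h) = 1`
    (Module.finrank ℤ Γ = 1 → ∀ h : Cartan Γ, cartanForm q h h = 1 →
      (∃! Φ : Coinv q 0 P ≃ₗ[ℂ] SymmetricAlgebra ℂ (Module.Dual ℂ P.OneForms),
        ∀ (v : Coinv q 0 P) (x : Sp P) (l : List x.a.Z),
          v.1 x = (outSub q 0 x.a.F).mkQ (monomial q 0 (l.map fun f => (h, f.1))) →
          Φ v = (l.map fun f => SymmetricAlgebra.ι ℂ _ (x.toDual f)).prod) ∧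
      (∃! Ψ : Coinv q 0 P ≃ₗ[ℂ] Fun P.OneForms,
        ∀ (v : Coinv q 0 P) (x : Sp P) (l : List x.a.Z),
          v.1 x = (outSub q 0 x.a.F).mkQ (monomial q 0 (l.map fun f => (h, f.1))) →
          ∀ η : P.OneForms, (Ψ v).1 η = (l.map fun f => x.toDual f η).prod)) := by
  refine ⟨eval_bijective q, existsUnique_canonicalEquiv q P, existsUnique_canonicalFunEquiv q P,
    fun hrank h hh => ?_⟩
  have h0 : h ≠ 0 := by
    rintro rfl
    exact one_ne_zero (hh.symm.trans ((cartanForm q).map_zero₂ 0))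
  have hspan : Submodule.span ℂ {h} = ⊤ :=
    (finrank_eq_one_iff_of_nonzero h h0).1 (Module.finrank_baseChange.trans hrank)
  exact ⟨existsUnique_rankOneEquiv q P h0 hspan, existsUnique_rankOneFunEquiv q P h0 hspan⟩
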